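/- Let $\mathcal H$ be a finite-dimensional complex Hilbert space, $\Theta\subset\mathbb R$, $\{\rho_\theta\}_{\theta\in\Theta}$ a family of density matrices on $\mathcal H$, and $\theta_1\in\Theta$. A POVM $M$ on $\mathcal H$ with data set $\Omega$ (a measurable space) is a countably additive map $B\mapsto M(B)$ from the measurable sets to the positive semidefinite operators with $M(\Omega)=I$; put $P^M_\rho(B)=\operatorname{Tr}\rho M(B)$ and let $D^M(\theta\|\theta')=D(P^M_{\rho_\theta}\|P^M_{\rho_{\theta'}})\in[0,\infty]$ be the Kullback--Leibler divergence. A POVM $M^n$ on $\mathcal H^{\otimes n}$ is *separable* if its operators have the form $M_1(\omega)\otimes\cdots\otimes M_n(\omega)$, $\omega\in\Omega$, with $M_l(\omega)\ge0$ on $\mathcal H$, i.e. $M^n(B)=\int_B M_1(\omega)\otimes\cdots\otimes M_n(\omega)\,\mu(d\omega)$ for some measure $\mu$ on $\Omega$ (the counting measure if $\Omega$ is discrete) and measurable $M_l$. It is *adaptive* if its data are $(\omega_1,\dots,\omega_n)$ and its operators have the form $M_1(\omega_1)\otimes M_2(\omega_1;\omega_2)\otimes\cdots\otimes M_n(\omega_1,\dots,\omega_{n-1};\omega_n)$,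 where $M_l(\omega_1,\dots,\omega_{l-1};\cdot)$ is a POVM on $\mathcal H$ for all past data $(\omega_1,\dots,\omega_{l-1})$ (densities being taken with respect to a $\sigma$-finite reference measure on the data set of one measurement, jointly measurable in the data). An estimator for $n$ copies is a pair $\mathcal E_n=(M^n,T_n)$ of a POVM $M^n$ on $\mathcal H^{\otimes n}$ and a measurable real function $T_n$ of its data; write $P^{M^n}_\theta=P^{M^n}_{\rho_\theta^{\otimes n}}$. A sequence $\vec M=\{(M^n,T_n)\}$ is *weakly consistent* if $P^{M^n}_\theta\{|T_n-\theta|>\epsilon\}\to0$ as $n\to\infty$ for all $\theta\in\Theta$, $\epsilon>0$. Put $$\beta(\vec M,\theta,\epsilon)=\limsup_{n\to\infty}-\tfrac1n\log P^{M^n}_\theta\{|T_n-\theta|>\epsilon\},\qquad \alpha(\vec M,\theta)=\limsup_{\epsilon\to+0}\frac{\beta(\vec M,\theta,\epsilon)}{\epsilon^2},$$ with values in $[0,\infty]$. **Theorem.** Let $\vec M$ be a weakly consistent sequence of estimators all of whose POVMs are separable. (1) For every $\epsilon>0$, $$\beta(\vec M,\theta_1,\epsilon)\le\inf_{\theta\in\Theta,\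 |\theta-\theta_1|>\epsilon}\ \sup_{M\text{ POVM on }\mathcal H}D^M(\theta\|\theta_1),$$ where the infimum over the empty set is $+\infty$. (2) Suppose that $\Theta$ contains $[\theta_1,\theta_1+\delta]$ or $[\theta_1-\delta,\theta_1]$ for some $\delta>0$, that $\ker\rho_{\theta_1}\subset\ker\rho_\theta$ for all $\theta\in\Theta$ close to $\theta_1$ (for instance $\rho_{\theta_1}>0$), and that $\theta\mapsto\rho_\theta$ is differentiable at $\theta_1$ within $\Theta$ and has a symmetric logarithmic derivative there, i.e. a Hermitian $L$ with $\frac{d\rho_\theta}{d\theta}\big|_{\theta=\theta_1}=\frac12(L\rho_{\theta_1}+\rho_{\theta_1}L)$. Then, for every such $L$, with the SLD Fisher information $J_{\theta_1}=\operatorname{Tr}L^2\rho_{\theta_1}$, $$\alpha(\vec M,\theta_1)\le\frac{J_{\theta_1}}2 .$$ (3) Every adaptive POVM on $\mathcal H^{\otimes n}$ is separable; in particular (1) and (2) hold for weakly consistent sequences of adaptive estimators. -/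

import Mathlib

open MeasureTheory Filter Topology
open scoped ENNReal ComplexOrder

universe u v

namespace QuantumEstimation

/-- A density matrix on the Hilbert space `ℂ^ι`. -/
structure DensityMatrix (ι : Type v) [Fintype ι] where
  toMatrix : Matrix ι ι ℂ
  posSemidef : toMatrix.PosSemidef
  trace_eq_one : toMatrix.trace = 1

/-- A positive operator valued measure on the data set `Ω`, acting on `ℂ^ι`: a countably additive
matrix-valued measure with positive semidefinite values and total mass `1`. -/
structure POVM (Ω : Type u) [MeasurableSpace Ω] (ι : Type v) [Fintype ι] [DecidableEq ι] where
  toVectorMeasure : VectorMeasure Ω (Matrix ι ι ℂ)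
  posSemidef : ∀ B : Set Ω, MeasurableSet B → (toVectorMeasure B).PosSemidef
  univ_eq_one : toVectorMeasure Set.univ = 1

theorem trace_mul_re_nonneg {ι : Type v} [Fintype ι] {A B : Matrix ι ι ℂ}
    (hA : A.PosSemidef) (hB : B.PosSemidef) : 0 ≤ (A * B).trace.re := by
  classical
  open scoped MatrixOrder Matrix.Norms.L2Operator in
  obtain ⟨C, rfl⟩ := CStarAlgebra.nonneg_iff_eq_star_mul_self.mp hA.nonneg
  have h := (hB.mul_mul_conjTranspose_same C).trace_nonneg
  have e : (star C * C * B).trace = (C * B * C.conjTranspose).trace := by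
    rw [Matrix.star_eq_conjTranspose, Matrix.mul_assoc, Matrix.trace_mul_comm]
  rw [e]
  exact (Complex.nonneg_iff.mp h).1

/-- The outcome distribution `B ↦ Tr (ρ M(B))` of the measurement `M` in the state `ρ`. -/
noncomputable def POVM.law {Ω : Type u} [MeasurableSpace Ω] {ι : Type v} [Fintype ι]
    [DecidableEq ι] (M : POVM Ω ι) (ρ : DensityMatrix ι) : Measure Ω :=
  Measure.ofMeasurable
    (fun B _ => ENNReal.ofReal (ρ.toMatrix * M.toVectorMeasure B).trace.re)
    (by simp)
    (by
      intro f hf hd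
      have h := M.toVectorMeasure.m_iUnion hf hd
      have hc : Continuous fun X : Matrix ι ι ℂ => (ρ.toMatrix * X).trace.re := by
        fun_prop
      have h2 : HasSum (fun i => (ρ.toMatrix * M.toVectorMeasure (f i)).trace.re)
          (ρ.toMatrix * M.toVectorMeasure (⋃ i, f i)).trace.re :=
        h.map (⟨⟨fun X : Matrix ι ι ℂ => (ρ.toMatrix * X).trace.re, by simp⟩,
          by intro X Y; simp [Matrix.mul_add, Matrix.trace_add]⟩ : Matrix ι ι ℂ →+ ℝ) hc
      rw [← h2.tsum_eq]
      exact ENNReal.ofReal_tsum_of_nonneg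
        (fun i => trace_mul_re_nonneg ρ.posSemidef (M.posSemidef _ (hf i))) h2.summable)

/-- The tensor product `A 0 ⊗ ⋯ ⊗ A (n - 1)`, as a matrix on `(ℂ^d)^{⊗ n} = ℂ^(Fin n → d)`. -/
def tensor {n : ℕ} {d : Type v} (A : Fin n → Matrix d d ℂ) :
    Matrix (Fin n → d) (Fin n → d) ℂ :=
  Matrix.of fun i j => ∏ l, A l (i l) (j l)

theorem tensor_posSemidef {n : ℕ} {d : Type v} [Fintype d] (A : Fin n → Matrix d d ℂ)
    (hA : ∀ l, (A l).PosSemidef) : (tensor A).PosSemidef := by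
  classical
  have h : ∀ l, ∃ C : Matrix d d ℂ, A l = C.conjTranspose * C := by
    intro l
    open scoped MatrixOrder Matrix.Norms.L2Operator in
    obtain ⟨C, hC⟩ := CStarAlgebra.nonneg_iff_eq_star_mul_self.mp (hA l).nonneg
    exact ⟨C, hC⟩
  choose C hC using h
  have e : tensor A = (tensor C).conjTranspose * tensor C := by
    ext i j
    simp only [tensor, hC, Matrix.mul_apply, Matrix.of_apply, Matrix.conjTranspose_apply,
      Fintype.prod_sum, Finset.prod_mul_distrib, star_prod]
  rw [e]
  exact Matrix.posSemidef_conjTranspose_mul_self _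

/-- The `n`-fold tensor power `ρ^{⊗ n}` of a density matrix. -/
def DensityMatrix.tensorPower {d : Type v} [Fintype d] (ρ : DensityMatrix d) (n : ℕ) :
    DensityMatrix (Fin n → d) where
  toMatrix := tensor fun _ => ρ.toMatrix
  posSemidef := tensor_posSemidef _ fun _ => ρ.posSemidef
  trace_eq_one := by
    have h := ρ.trace_eq_one
    simp only [Matrix.trace, Matrix.diag] at h
    simp only [Matrix.trace, Matrix.diag, tensor, Matrix.of_apply]
    rw [← Fintype.prod_sum fun (_ : Fin n) i => ρ.toMatrix i i]
    simp [h]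

section Measurements

variable {Ω : Type u} [MeasurableSpace Ω] {d : Type v} [Fintype d] [DecidableEq d] {n : ℕ}

/-- `M(B) = ∫_B G dμ` for all measurable `B` (entrywise integrals). For a countable discrete data
set and the counting measure `μ` this says that `M` is the discrete POVM `{G ω}_ω`. -/
def POVM.HasDensity {ι : Type v} [Fintype ι] [DecidableEq ι] (M : POVM Ω ι) (μ : Measure Ω)
    (G : Ω → Matrix ι ι ℂ) : Prop :=
  ∀ i j, Integrable (fun ω => G ω i j) μ ∧
    ∀ B : Set Ω, MeasurableSet B → M.toVectorMeasure B i j = ∫ ω in B, G ω i j ∂μ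

/-- A POVM on `(ℂ^d)^{⊗ n}` is separable if its operators are `F 0 ω ⊗ ⋯ ⊗ F (n - 1) ω` with
positive semidefinite `F l ω` on `ℂ^d`, with respect to some reference measure on the data set
(the counting measure, if the data set is discrete). -/
def POVM.IsSeparable (M : POVM Ω (Fin n → d)) : Prop :=
  ∃ (μ : Measure Ω) (F : Fin n → Ω → Matrix d d ℂ),
    (∀ l ω, (F l ω).PosSemidef) ∧
    (∀ l i j, Measurable fun ω => F l ω i j) ∧
    M.HasDensity μ fun ω => tensor fun l => F l ω

/-- A POVM on `(ℂ^d)^{⊗ n}` with data `(ω 0, …, ω (n - 1))` is adaptive if its operators are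
`F 0 (ω 0) ⊗ F 1 (ω 0; ω 1) ⊗ ⋯`, where for all past data `p = (ω 0, …, ω (l - 1))` the operators
`F l p ω` form a POVM `N l p` on `ℂ^d` (densities are taken with respect to a `σ`-finite measure
on the data set of a single measurement). -/
def POVM.IsAdaptive (M : POVM (Fin n → Ω) (Fin n → d)) : Prop :=
  ∃ (ν : Measure Ω) (_ : SigmaFinite ν)
    (N : (l : Fin n) → (Fin l → Ω) → POVM Ω d)
    (F : (l : Fin n) → (Fin l → Ω) → Ω → Matrix d d ℂ),
    (∀ l p ω, (F l p ω).PosSemidef) ∧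
    (∀ (l : Fin n) (i j : d), Measurable fun q : (Fin l → Ω) × Ω => F l q.1 q.2 i j) ∧
    (∀ l p, (N l p).HasDensity ν (F l p)) ∧
    M.HasDensity (Measure.pi fun _ => ν)
      fun ω => tensor fun l : Fin n => F l (fun k => ω (Fin.castLE l.isLt.le k)) (ω l)

end Measurements

/-- An estimator from `n` copies: a POVM on `(ℂ^d)^{⊗ n}` and a real function of its data. -/
structure Estimator (d : Type v) [Fintype d] [DecidableEq d] (n : ℕ) where
  Ω : Type u
  [measurableSpace : MeasurableSpace Ω]
  povm : POVM Ω (Fin n → d)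
  est : Ω → ℝ
  measurable_est : Measurable est

attribute [instance] Estimator.measurableSpace

section Performance

variable {d : Type v} [Fintype d] [DecidableEq d]

/-- The probability, in the state `σ^{⊗ n}`, that the estimate differs from `θ` by more
than `ε`. -/
noncomputable def Estimator.tailProb {n : ℕ} (E : Estimator.{u} d n) (σ : DensityMatrix d)
    (θ ε : ℝ) : ℝ≥0∞ :=
  E.povm.law (σ.tensorPower n) {ω | ε < |E.est ω - θ|}

/-- Weak consistency of a sequence of estimators for the family `ρ θ`, `θ ∈ Θ`. -/
def WeaklyConsistent (Θ : Set ℝ) (ρ : ℝ → DensityMatrix d)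
    (E : (n : ℕ) → Estimator.{u} d n) : Prop :=
  ∀ θ ∈ Θ, ∀ ε > 0, Tendsto (fun n => (E n).tailProb (ρ θ) θ ε) atTop (𝓝 0)

/-- `β(E, θ, ε) = limsup_n -(1/n) log P_θ {|estimate - θ| > ε}` (with `-log 0 = ∞`). -/
noncomputable def beta (ρ : ℝ → DensityMatrix d) (E : (n : ℕ) → Estimator.{u} d n)
    (θ ε : ℝ) : EReal :=
  limsup (fun n : ℕ => -ENNReal.log ((E n).tailProb (ρ θ) θ ε) / ((n : ℝ) : EReal)) atTop

/-- `α(E, θ) = limsup_{ε → +0} β(E, θ, ε) / ε²`. -/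
noncomputable def alpha (ρ : ℝ → DensityMatrix d) (E : (n : ℕ) → Estimator.{u} d n)
    (θ : ℝ) : EReal :=
  limsup (fun ε : ℝ => beta ρ E θ ε / ((ε ^ 2 : ℝ) : EReal)) (𝓝[>] 0)

/-- `sup_M D(P^M_ρ ‖ P^M_σ)` over all POVMs `M` on the single system `ℂ^d`. -/
noncomputable def supMeasuredDiv (ρ σ : DensityMatrix d) : ℝ≥0∞ :=
  ⨆ (Ω : Type u) (_ : MeasurableSpace Ω) (M : POVM Ω d),
    InformationTheory.klDiv (M.law ρ) (M.law σ)

/-- `L` is a symmetric logarithmic derivative of the family `ρ θ`, `θ ∈ Θ`, at `θ`: a Hermitian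
solution of `dρ/dθ = (L ρ + ρ L) / 2`; the derivative is taken inside `Θ`. -/
def IsSLD (Θ : Set ℝ) (ρ : ℝ → DensityMatrix d) (θ : ℝ) (L : Matrix d d ℂ) : Prop :=
  L.IsHermitian ∧ ∀ i j, HasDerivWithinAt (fun t => (ρ t).toMatrix i j)
    ((L * (ρ θ).toMatrix + (ρ θ).toMatrix * L) i j / 2) Θ θ

/-- The SLD Fisher information `Tr L² ρ` of a state `ρ` with symmetric logarithmic
derivative `L`. -/
noncomputable def sldFisher (ρ : DensityMatrix d) (L : Matrix d d ℂ) : ℝ :=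
  (L * L * ρ.toMatrix).trace.re

end Performance

end QuantumEstimation

/-! A separable measurement has a likelihood that factors over the copies. With `p k = Tr ρ F_k` and
`q k = Tr σ F_k`, its laws in `ρ^{⊗n}` and `σ^{⊗n}` have densities `∏ p k` and `∏ q k`, so the
log-likelihood ratio is the sum of the `log (p l / q l)`. The mean of the `l`-th term is itself a
one-system divergence: prepare all systems but `l` in the state `ρ` and regard the whole measurement
as a POVM on system `l` (`POVM.reduce`). Its densities in `ρ` and `σ` are `w * p l` and `w * q l`
with the same weight `w`, which cancels in the ratio. Hence the total divergence is at most `n`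
times the supremum over one-system POVMs.

Coarse-graining to an event `A` gives `P(A) * -log Q(A) ≤ n C + 1` (`POVM.IsSeparable.neg_log_le`).
If `A` is the tail event around `θ₁` and the true parameter `θ` lies outside the window, consistency
forces `P(A) → 1`, and (1) follows after division by `n`.

For (2) it remains to show that the supremum is at most `(J / 2 + o(1)) (θ - θ₁)²`
(`IsSLD.eventually_supMeasuredDiv_le`). Near `θ₁` the divergence is bounded by half a chi-square
quantity, up to a factor tending to `1`. Positivity of `(1 - u L) σ (1 - u L)ᴴ` bounds its main term
by `Tr L σ L` uniformly in the measurement. The kernel condition makes the Taylor remainder small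
relative to `σ`. Parameters at distance `b ε` from `θ₁`, with `b` close to `1` from above, then
bound `α`. -/

namespace QuantumEstimation

/-! ### Algebra of tensor products of matrices -/

section TensorAlgebra

variable {n : ℕ} {d : Type v}

theorem tensor_mul [Fintype d] (A B : Fin n → Matrix d d ℂ) :
    tensor A * tensor B = tensor fun l => A l * B l := by
  ext i j
  simp only [tensor, Matrix.mul_apply, Matrix.of_apply, Fintype.prod_sum, Finset.prod_mul_distrib]

theorem trace_tensor [Fintype d] (A : Fin n → Matrix d d ℂ) :
    (tensor A).trace = ∏ l, (A l).trace := by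
  simp only [Matrix.trace, Matrix.diag, tensor, Matrix.of_apply]
  rw [← Fintype.prod_sum fun l i => A l i i]

theorem conjTranspose_tensor (A : Fin n → Matrix d d ℂ) :
    (tensor A).conjTranspose = tensor fun l => (A l).conjTranspose := by
  ext i j
  simp [tensor, Matrix.conjTranspose_apply]

theorem tensor_update_apply (A : Fin n → Matrix d d ℂ) (l : Fin n) (X : Matrix d d ℂ)
    (i j : Fin n → d) :
    tensor (Function.update A l X) i j =
      (∏ k ∈ Finset.univ.erase l, A k (i k) (j k)) * X (i l) (j l) := by
  rw [tensor, Matrix.of_apply, ← Finset.prod_erase_mul _ _ (Finset.mem_univ l)]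
  congr 1
  · refine Finset.prod_congr rfl fun k hk => ?_
    rw [Function.update_of_ne (Finset.ne_of_mem_erase hk)]
  · rw [Function.update_self]

/-- Linearity in one slot, expanded in matrix units; it extends identities from matrix units to
arbitrary matrices in slot `l`. -/
theorem tensor_update_eq_sum [Fintype d] [DecidableEq d] (A : Fin n → Matrix d d ℂ) (l : Fin n)
    (X : Matrix d d ℂ) :
    tensor (Function.update A l X) =
      ∑ a, ∑ b, X a b • tensor (Function.update A l (Matrix.single a b 1)) := by
  ext i j
  simp only [Matrix.sum_apply, Matrix.smul_apply, tensor_update_apply, smul_eq_mul]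
  rw [Finset.sum_eq_single (i l), Finset.sum_eq_single (j l)]
  · simp [mul_comm]
  · intro b _ hb
    simp [hb]
  · simp
  · intro a _ ha
    simp [ha]
  · simp

end TensorAlgebra

/-! ### Traces of products of Hermitian and positive matrices -/

section TraceLemmas

variable {ι : Type v} [Fintype ι]

theorem trace_mul_eq_ofReal {A B : Matrix ι ι ℂ} (hA : A.IsHermitian) (hB : B.IsHermitian) :
    (A * B).trace = ((A * B).trace.re : ℂ) := by
  refine (Complex.conj_eq_iff_re.mp ?_).symm
  rw [starRingEnd_apply, ← Matrix.trace_conjTranspose, Matrix.conjTranspose_mul, hA.eq, hB.eq,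
    Matrix.trace_mul_comm]

theorem trace_mul_nonneg {A B : Matrix ι ι ℂ} (hA : A.PosSemidef) (hB : B.PosSemidef) :
    0 ≤ (A * B).trace := by
  rw [trace_mul_eq_ofReal hA.isHermitian hB.isHermitian]
  exact_mod_cast trace_mul_re_nonneg hA hB

/-- The trace against the rank-one matrix `x xᴴ` is the quadratic form of `X` at `x`. -/
theorem posSemidef_of_trace_mul_nonneg {X : Matrix ι ι ℂ} (hX : X.IsHermitian)
    (h : ∀ x : ι → ℂ, 0 ≤ (Matrix.vecMulVec x (star x) * X).trace) : X.PosSemidef := by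
  refine Matrix.PosSemidef.of_dotProduct_mulVec_nonneg hX fun x => ?_
  have := h x
  rwa [Matrix.trace_mul_comm, Matrix.mul_vecMulVec, Matrix.trace_vecMulVec, dotProduct_comm] at this

end TraceLemmas

/-! ### Product states with one factor replaced -/

section Update

variable {n : ℕ} {d : Type v} [Fintype d] {Ω : Type u} [MeasurableSpace Ω]

theorem update_posSemidef (ρ τ : DensityMatrix d) (l k : Fin n) :
    (Function.update (fun _ => ρ.toMatrix) l τ.toMatrix k).PosSemidef := by
  rcases eq_or_ne k l with rfl | hk
  · simpa using τ.posSemidef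
  · simpa [Function.update_of_ne hk] using ρ.posSemidef

theorem prod_update_trace (ρ τ : DensityMatrix d) (l : Fin n) (G : Fin n → Matrix d d ℂ) :
    ∏ k, (Function.update (fun _ => ρ.toMatrix) l τ.toMatrix k * G k).trace.re =
      (∏ k ∈ Finset.univ.erase l, (ρ.toMatrix * G k).trace.re) * (τ.toMatrix * G l).trace.re := by
  rw [← Finset.prod_erase_mul _ _ (Finset.mem_univ l), Function.update_self]
  congr 1
  exact Finset.prod_congr rfl fun k hk => by rw [Function.update_of_ne (Finset.ne_of_mem_erase hk)]

theorem measurable_trace_mul {G : Ω → Matrix d d ℂ} (hG : ∀ i j, Measurable fun ω => G ω i j)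
    (T : Matrix d d ℂ) : Measurable fun ω => (T * G ω).trace.re := by
  refine Complex.measurable_re.comp ?_
  simp only [Matrix.trace, Matrix.diag, Matrix.mul_apply]
  fun_prop

end Update

/-! ### Partial trace and the reduced one-system measurement -/

section PartialTrace

variable {n : ℕ} {d : Type v} [Fintype d] [DecidableEq d]

/-- The map `X ↦ Tr_{k ≠ l} ((⊗_{k ≠ l} A k) X)` on matrices on `(ℂ^d)^{⊗ n}`. -/
def partialTrace (A : Fin n → Matrix d d ℂ) (l : Fin n) :
    Matrix (Fin n → d) (Fin n → d) ℂ →+ Matrix d d ℂ where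
  -- The indices are swapped because `Tr (single b a 1 * Y) = Y a b`.
  toFun X := Matrix.of fun a b => (tensor (Function.update A l (Matrix.single b a 1)) * X).trace
  map_zero' := by ext; simp
  map_add' X Y := by ext; simp [Matrix.mul_add]

theorem partialTrace_apply (A : Fin n → Matrix d d ℂ) (l : Fin n)
    (X : Matrix (Fin n → d) (Fin n → d) ℂ) (a b : d) :
    partialTrace A l X a b = (tensor (Function.update A l (Matrix.single b a 1)) * X).trace :=
  rfl

theorem continuous_partialTrace (A : Fin n → Matrix d d ℂ) (l : Fin n) :
    Continuous (partialTrace A l) := by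
  refine continuous_matrix fun a b => ?_
  simp only [partialTrace_apply]
  fun_prop

/-- The duality that characterises the partial trace. By linearity in slot `l` it reduces to matrix
units, where it is the definition. -/
theorem trace_mul_partialTrace (A : Fin n → Matrix d d ℂ) (l : Fin n) (T : Matrix d d ℂ)
    (X : Matrix (Fin n → d) (Fin n → d) ℂ) :
    (T * partialTrace A l X).trace = (tensor (Function.update A l T) * X).trace := by
  rw [tensor_update_eq_sum A l T, Matrix.sum_mul, Matrix.trace_sum]
  simp_rw [Matrix.sum_mul, Matrix.trace_sum, Matrix.smul_mul, Matrix.trace_smul]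
  simp [Matrix.trace, Matrix.mul_apply (M := T), partialTrace_apply]

/-- By duality, testing against `x xᴴ` amounts to testing `X` against a tensor product of positive
matrices. -/
theorem partialTrace_posSemidef {A : Fin n → Matrix d d ℂ} (hA : ∀ k, (A k).PosSemidef)
    (l : Fin n) {X : Matrix (Fin n → d) (Fin n → d) ℂ} (hX : X.PosSemidef) :
    (partialTrace A l X).PosSemidef := by
  refine posSemidef_of_trace_mul_nonneg ?_ fun x => ?_
  · ext a b
    rw [Matrix.conjTranspose_apply, partialTrace_apply, partialTrace_apply,
      ← Matrix.trace_conjTranspose, Matrix.conjTranspose_mul, conjTranspose_tensor,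
      hX.isHermitian.eq, Matrix.trace_mul_comm]
    congr 3
    funext k
    rcases eq_or_ne k l with rfl | hk
    · simp [Matrix.conjTranspose_single]
    · simp [Function.update_of_ne hk, (hA k).isHermitian.eq]
  · rw [trace_mul_partialTrace]
    refine trace_mul_nonneg (tensor_posSemidef _ fun k => ?_) hX
    rcases eq_or_ne k l with rfl | hk
    · simpa using Matrix.posSemidef_vecMulVec_self_star x
    · simpa [Function.update_of_ne hk] using hA k

theorem partialTrace_one {A : Fin n → Matrix d d ℂ} (hA : ∀ k, (A k).trace = 1) (l : Fin n) :
    partialTrace A l 1 = 1 := by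
  ext a b
  rw [partialTrace_apply, Matrix.mul_one, trace_tensor,
    Finset.prod_eq_single l]
  · rcases eq_or_ne a b with rfl | h
    · simp
    · simp [h, h.symm]
  · intro k _ hk
    rw [Function.update_of_ne hk, hA]
  · simp

variable {Ω : Type u} [MeasurableSpace Ω]

/-- The measurement on the `l`-th system obtained from a measurement on `(ℂ^d)^{⊗ n}` by preparing
all other systems in the state `ρ`. -/
noncomputable def POVM.reduce (M : POVM Ω (Fin n → d)) (ρ : DensityMatrix d) (l : Fin n) :
    POVM Ω d where
  toVectorMeasure := M.toVectorMeasure.mapRange (partialTrace (fun _ => ρ.toMatrix) l)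
    (continuous_partialTrace _ l)
  posSemidef B hB := by
    rw [VectorMeasure.mapRange_apply]
    exact partialTrace_posSemidef (fun _ => ρ.posSemidef) l (M.posSemidef B hB)
  univ_eq_one := by
    rw [VectorMeasure.mapRange_apply, M.univ_eq_one]
    exact partialTrace_one (fun _ => ρ.trace_eq_one) l

theorem POVM.trace_mul_reduce (M : POVM Ω (Fin n → d)) (ρ τ : DensityMatrix d) (l : Fin n)
    (B : Set Ω) :
    (τ.toMatrix * (M.reduce ρ l).toVectorMeasure B).trace =
      (tensor (Function.update (fun _ => ρ.toMatrix) l τ.toMatrix) * M.toVectorMeasure B).trace :=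
  trace_mul_partialTrace _ l _ _

end PartialTrace

/-! ### Outcome laws and their densities -/

section Laws

variable {Ω : Type u} [MeasurableSpace Ω] {ι : Type v} [Fintype ι] [DecidableEq ι]

theorem POVM.law_apply (M : POVM Ω ι) (ρ : DensityMatrix ι) {B : Set Ω} (hB : MeasurableSet B) :
    M.law ρ B = ENNReal.ofReal (ρ.toMatrix * M.toVectorMeasure B).trace.re :=
  Measure.ofMeasurable_apply B hB

instance (M : POVM Ω ι) (ρ : DensityMatrix ι) : IsProbabilityMeasure (M.law ρ) :=
  ⟨by rw [M.law_apply ρ MeasurableSet.univ, M.univ_eq_one, mul_one, ρ.trace_eq_one]; simp⟩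

theorem POVM.law_real_apply (M : POVM Ω ι) (ρ : DensityMatrix ι) {B : Set Ω}
    (hB : MeasurableSet B) :
    (M.law ρ).real B = (ρ.toMatrix * M.toVectorMeasure B).trace.re := by
  rw [measureReal_def, M.law_apply ρ hB,
    ENNReal.toReal_ofReal (trace_mul_re_nonneg ρ.posSemidef (M.posSemidef B hB))]

theorem POVM.law_eq_withDensity (M : POVM Ω ι) (ρ : DensityMatrix ι) {μ : Measure Ω} {f : Ω → ℝ}
    (hf : Integrable f μ) (h0 : ∀ ω, 0 ≤ f ω)
    (h : ∀ B, MeasurableSet B → (ρ.toMatrix * M.toVectorMeasure B).trace.re = ∫ ω in B, f ω ∂μ) :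
    M.law ρ = μ.withDensity fun ω => ENNReal.ofReal (f ω) := by
  ext B hB
  rw [M.law_apply ρ hB, h B hB, withDensity_apply _ hB,
    ofReal_integral_eq_lintegral_ofReal hf.restrict (ae_of_all _ h0)]

theorem POVM.HasDensity.integrable_trace_mul {M : POVM Ω ι} {μ : Measure Ω} {G : Ω → Matrix ι ι ℂ}
    (h : M.HasDensity μ G) (T : Matrix ι ι ℂ) : Integrable (fun ω => (T * G ω).trace) μ := by
  simp only [Matrix.trace, Matrix.diag, Matrix.mul_apply]
  exact integrable_finsetSum _ fun i _ => integrable_finsetSum _ fun j _ =>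
    ((h j i).1.const_mul _)

theorem POVM.HasDensity.trace_mul {M : POVM Ω ι} {μ : Measure Ω} {G : Ω → Matrix ι ι ℂ}
    (h : M.HasDensity μ G) (T : Matrix ι ι ℂ) {B : Set Ω} (hB : MeasurableSet B) :
    (T * M.toVectorMeasure B).trace = ∫ ω in B, (T * G ω).trace ∂μ := by
  have hi : ∀ i j, Integrable (fun ω => T i j * G ω j i) (μ.restrict B) := fun i j =>
    (h j i).1.restrict.const_mul _
  have h1 : ∀ ω, (T * G ω).trace = ∑ i, ∑ j, T i j * G ω j i := fun ω => by
    simp [Matrix.trace, Matrix.mul_apply]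
  simp_rw [h1]
  rw [integral_finsetSum _ fun i _ => integrable_finsetSum _ fun j _ => hi i j]
  simp only [Matrix.trace, Matrix.diag, Matrix.mul_apply]
  refine Finset.sum_congr rfl fun i _ => ?_
  rw [integral_finsetSum _ fun j _ => hi i j]
  refine Finset.sum_congr rfl fun j _ => ?_
  rw [integral_const_mul, (h j i).2 B hB]

theorem trace_tensor_mul_tensor {n : ℕ} {d : Type v} [Fintype d] {A F : Fin n → Matrix d d ℂ}
    (hA : ∀ k, (A k).PosSemidef) (hF : ∀ k, (F k).PosSemidef) :
    (tensor A * tensor F).trace = ((∏ k, (A k * F k).trace.re : ℝ) : ℂ) := by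
  rw [tensor_mul, trace_tensor, Complex.ofReal_prod]
  exact Finset.prod_congr rfl fun k _ => trace_mul_eq_ofReal (hA k).isHermitian (hF k).isHermitian

section Separable

variable {n : ℕ} {d : Type v} [Fintype d] [DecidableEq d] {M : POVM Ω (Fin n → d)} {μ : Measure Ω}
  {F : Fin n → Ω → Matrix d d ℂ}

theorem POVM.HasDensity.integrable_prod_trace (h : M.HasDensity μ fun ω => tensor fun l => F l ω)
    (hF : ∀ l ω, (F l ω).PosSemidef) {A : Fin n → Matrix d d ℂ} (hA : ∀ k, (A k).PosSemidef) :
    Integrable (fun ω => ∏ k, (A k * F k ω).trace.re) μ := by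
  refine (h.integrable_trace_mul (tensor A)).re.congr (ae_of_all _ fun ω => ?_)
  simp only [trace_tensor_mul_tensor hA fun k => hF k ω]
  exact Complex.ofReal_re _

theorem POVM.HasDensity.trace_tensor_mul (h : M.HasDensity μ fun ω => tensor fun l => F l ω)
    (hF : ∀ l ω, (F l ω).PosSemidef) {A : Fin n → Matrix d d ℂ} (hA : ∀ k, (A k).PosSemidef)
    {B : Set Ω} (hB : MeasurableSet B) :
    (tensor A * M.toVectorMeasure B).trace.re = ∫ ω in B, ∏ k, (A k * F k ω).trace.re ∂μ := by
  rw [h.trace_mul (tensor A) hB]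
  simp only [trace_tensor_mul_tensor hA fun k => hF k _]
  rw [integral_complex_ofReal, Complex.ofReal_re]

theorem POVM.HasDensity.integrable_reduce (h : M.HasDensity μ fun ω => tensor fun l => F l ω)
    (hF : ∀ l ω, (F l ω).PosSemidef) (ρ τ : DensityMatrix d) (l : Fin n) :
    Integrable (fun ω => (∏ k ∈ Finset.univ.erase l, (ρ.toMatrix * F k ω).trace.re) *
      (τ.toMatrix * F l ω).trace.re) μ := by
  simpa only [prod_update_trace] using h.integrable_prod_trace hF (update_posSemidef ρ τ l)

/-- The weight in front does not depend on `τ`, so it disappears from likelihood ratios between two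
states of system `l`. -/
theorem POVM.HasDensity.law_reduce (h : M.HasDensity μ fun ω => tensor fun l => F l ω)
    (hF : ∀ l ω, (F l ω).PosSemidef) (ρ τ : DensityMatrix d) (l : Fin n) :
    (M.reduce ρ l).law τ = μ.withDensity fun ω =>
      ENNReal.ofReal ((∏ k ∈ Finset.univ.erase l, (ρ.toMatrix * F k ω).trace.re) *
        (τ.toMatrix * F l ω).trace.re) := by
  refine POVM.law_eq_withDensity _ _ (h.integrable_reduce hF ρ τ l)
    (fun ω => mul_nonneg (Finset.prod_nonneg fun k _ =>
      trace_mul_re_nonneg ρ.posSemidef (hF k ω)) (trace_mul_re_nonneg τ.posSemidef (hF l ω)))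
    fun B hB => ?_
  rw [POVM.trace_mul_reduce, h.trace_tensor_mul hF (update_posSemidef ρ τ l) hB]
  simp only [prod_update_trace]

end Separable

/-- Each conditional factor, read as a function of the complete data record, is a separable factor
over the product reference measure. Measurability comes from composing with the projection to past
and present data. -/
theorem POVM.IsAdaptive.isSeparable {n : ℕ} {d : Type v} [Fintype d] [DecidableEq d]
    {M : POVM (Fin n → Ω) (Fin n → d)} (h : M.IsAdaptive) : M.IsSeparable := by
  obtain ⟨ν, _, N, F, hF, hmeas, -, hd⟩ := h
  refine ⟨Measure.pi fun _ => ν,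
    fun l ω => F l (fun k => ω (Fin.castLE l.isLt.le k)) (ω l), fun l ω => hF _ _ _,
    fun l i j => ?_, hd⟩
  have hp : Measurable fun ω : Fin n → Ω =>
      ((fun k : Fin l => ω (Fin.castLE l.isLt.le k)), ω l) :=
    (measurable_pi_lambda _ fun k => measurable_pi_apply _).prodMk (measurable_pi_apply l)
  exact (hmeas l i j).comp hp

end Laws

/-! ### Kullback–Leibler divergence through densities -/

section KullbackLeibler

variable {Ω : Type u} [MeasurableSpace Ω]

/-- The reference measure `μ` need not be `σ`-finite, so the Radon–Nikodym derivative is found by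
writing `P` as a density over the probability measure `Q`. Where `g = 0`, almost everywhere `f = 0`
too, so the value of `f / g` there is harmless. -/
theorem klDiv_withDensity {μ : Measure Ω} {f g : Ω → ℝ} (hf : Measurable f) (hg : Measurable g)
    (hf0 : ∀ ω, 0 ≤ f ω) (hg0 : ∀ ω, 0 ≤ g ω)
    [IsProbabilityMeasure (μ.withDensity fun ω => ENNReal.ofReal (f ω))]
    [IsProbabilityMeasure (μ.withDensity fun ω => ENNReal.ofReal (g ω))]
    (h : InformationTheory.klDiv (μ.withDensity fun ω => ENNReal.ofReal (f ω))
      (μ.withDensity fun ω => ENNReal.ofReal (g ω)) ≠ ∞) :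
    (∀ᵐ ω ∂μ, g ω = 0 → f ω = 0) ∧ Integrable (fun ω => f ω * Real.log (f ω / g ω)) μ ∧
      ∫ ω, f ω * Real.log (f ω / g ω) ∂μ =
        (InformationTheory.klDiv (μ.withDensity fun ω => ENNReal.ofReal (f ω))
          (μ.withDensity fun ω => ENNReal.ofReal (g ω))).toReal := by
  set P := μ.withDensity fun ω => ENNReal.ofReal (f ω) with hP
  set Q := μ.withDensity fun ω => ENNReal.ofReal (g ω) with hQ
  obtain ⟨hac, hint⟩ := InformationTheory.klDiv_ne_top_iff.mp h
  have h0 : ∀ᵐ ω ∂μ, g ω = 0 → f ω = 0 := by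
    have hs : MeasurableSet {ω | g ω = 0} := hg (measurableSet_singleton 0)
    have hQs : Q {ω | g ω = 0} = 0 := by
      rw [hQ, withDensity_apply _ hs]
      refine (lintegral_eq_zero_iff (by fun_prop)).mpr ((ae_restrict_iff' hs).mpr (ae_of_all _ ?_))
      intro ω hω
      simp [show g ω = 0 from hω]
    have hPs := hac hQs
    rw [hP, withDensity_apply _ hs, lintegral_eq_zero_iff (by fun_prop),
      EventuallyEq, ae_restrict_iff' hs] at hPs
    filter_upwards [hPs] with ω hω hgω
    exact le_antisymm (by simpa using hω hgω) (hf0 ω)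
  have hPQ : P = Q.withDensity fun ω => ENNReal.ofReal (f ω / g ω) := by
    rw [hQ, ← withDensity_mul _ (by fun_prop) (by fun_prop)]
    refine withDensity_congr_ae ?_
    filter_upwards [h0] with ω hω
    rw [Pi.mul_apply, ← ENNReal.ofReal_mul (hg0 ω)]
    rcases eq_or_ne (g ω) 0 with h | h
    · simp [h, hω h]
    · rw [mul_div_cancel₀ _ h]
  have hr : P.rnDeriv Q =ᵐ[P] fun ω => ENNReal.ofReal (f ω / g ω) := by
    refine hac.ae_eq ?_
    rw [hPQ]
    exact Measure.rnDeriv_withDensity _ (by fun_prop)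
  have hl : llr P Q =ᵐ[P] fun ω => Real.log (f ω / g ω) := by
    filter_upwards [hr] with ω hω
    rw [llr, hω, ENNReal.toReal_ofReal (div_nonneg (hf0 ω) (hg0 ω))]
  refine ⟨h0, ?_, ?_⟩
  · have := hint.congr hl
    rw [hP, integrable_withDensity_iff_integrable_smul' (by fun_prop) (by simp)] at this
    simpa [hf0] using this
  · rw [InformationTheory.toReal_klDiv_of_measure_eq hac (by simp), integral_congr_ae hl, hP,
      integral_withDensity_eq_integral_toReal_smul₀ (by fun_prop) (by simp)]
    simp [hf0]

/-- The tangent-line bound `log t ≤ t - 1` at `t = c y / x`, multiplied by `x`. -/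
theorem sub_le_mul_log_div {x y c : ℝ} (hx : 0 ≤ x) (hy : 0 ≤ y) (hxy : y = 0 → x = 0)
    (hc : 0 < c) : x * Real.log c + x - c * y ≤ x * Real.log (x / y) := by
  rcases hx.eq_or_lt with rfl | hx
  · simp; positivity
  have hy : 0 < y := hy.lt_of_ne fun h => hx.ne' (hxy h.symm)
  have h1 := Real.log_le_sub_one_of_pos (show 0 < c * (y / x) by positivity)
  rw [Real.log_mul hc.ne' (by positivity), ← inv_div x y, Real.log_inv] at h1
  have h2 := mul_le_mul_of_nonneg_left h1 hx.le
  have h3 : x * (c * (x / y)⁻¹ - 1) = c * y - x := by field_simp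
  linarith

theorem neg_log_le_of_forall_mul_log_le {a b K : ℝ} (ha : 0 < a) (hb : 0 ≤ b)
    (key : ∀ c : ℝ, 0 < c → a * Real.log c - c * b + b ≤ K) :
    0 < b ∧ a * -Real.log b ≤ K + 1 := by
  have hb : 0 < b := by
    refine hb.lt_of_ne fun h => ?_
    -- If `b = 0`, the left side is `a log c`, and this `c` makes it `K + 1`.
    have := key (Real.exp ((K + 1) / a)) (Real.exp_pos _)
    rw [Real.log_exp, mul_div_cancel₀ _ ha.ne', ← h] at this
    linarith
  refine ⟨hb, ?_⟩
  -- The choice `c = 1 / b` is not optimal, but it costs only the additive constant `1`.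
  have := key b⁻¹ (by positivity)
  rw [Real.log_inv, inv_mul_cancel₀ hb.ne'] at this
  linarith

end KullbackLeibler

/-! ### The `n`-copy converse bound for separable measurements -/

section Converse

variable {Ω : Type u} [MeasurableSpace Ω] {d : Type v} [Fintype d] [DecidableEq d] {n : ℕ}

theorem klDiv_law_le_supMeasuredDiv (M : POVM Ω d) (ρ σ : DensityMatrix d) :
    InformationTheory.klDiv (M.law ρ) (M.law σ) ≤ supMeasuredDiv.{u} ρ σ :=
  le_iSup_of_le Ω (le_iSup_of_le _ (le_iSup_of_le M le_rfl))

/-- A linearised data-processing inequality for the partition into `A` and its complement. Keeping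
`c` free avoids logarithms of probabilities that might vanish. -/
theorem POVM.IsSeparable.mul_log_le {M : POVM Ω (Fin n → d)} (hM : M.IsSeparable)
    (ρ σ : DensityMatrix d) (hC : supMeasuredDiv.{u} ρ σ ≠ ∞) {A : Set Ω} (hA : MeasurableSet A)
    {c : ℝ} (hc : 0 < c) :
    (M.law (ρ.tensorPower n)).real A * Real.log c - c * (M.law (σ.tensorPower n)).real A +
        (M.law (σ.tensorPower n)).real A ≤ n * (supMeasuredDiv.{u} ρ σ).toReal := by
  obtain ⟨μ, F, hF, hFm, hd⟩ := hM
  set p : Fin n → Ω → ℝ := fun k ω => (ρ.toMatrix * F k ω).trace.re with hp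
  set q : Fin n → Ω → ℝ := fun k ω => (σ.toMatrix * F k ω).trace.re with hq
  have hp0 : ∀ k ω, 0 ≤ p k ω := fun k ω => trace_mul_re_nonneg ρ.posSemidef (hF k ω)
  have hq0 : ∀ k ω, 0 ≤ q k ω := fun k ω => trace_mul_re_nonneg σ.posSemidef (hF k ω)
  have hpm : ∀ k, Measurable (p k) := fun k => measurable_trace_mul (hFm k) _
  have hqm : ∀ k, Measurable (q k) := fun k => measurable_trace_mul (hFm k) _
  set w : Fin n → Ω → ℝ := fun l ω => ∏ k ∈ Finset.univ.erase l, p k ω with hw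
  have hw0 : ∀ l ω, 0 ≤ w l ω := fun l ω => Finset.prod_nonneg fun k _ => hp0 k ω
  have hwm : ∀ l, Measurable (w l) := fun l => Finset.measurable_fun_prod _ fun k _ => hpm k
  have hwp : ∀ l ω, w l ω * p l ω = ∏ k, p k ω := fun l ω =>
    Finset.prod_erase_mul _ _ (Finset.mem_univ l)
  -- Each summand is the divergence of the laws of `M.reduce ρ l`, a POVM on one system with the
  -- same data set, and is therefore bounded by the supremum.
  have key : ∀ l, (∀ᵐ ω ∂μ, q l ω = 0 → ∏ k, p k ω = 0) ∧
      Integrable (fun ω => (∏ k, p k ω) * Real.log (p l ω / q l ω)) μ ∧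
      ∫ ω, (∏ k, p k ω) * Real.log (p l ω / q l ω) ∂μ ≤ (supMeasuredDiv.{u} ρ σ).toReal := by
    intro l
    have hle := klDiv_law_le_supMeasuredDiv (M.reduce ρ l) ρ σ
    have i1 : IsProbabilityMeasure ((M.reduce ρ l).law ρ) := inferInstance
    have i2 : IsProbabilityMeasure ((M.reduce ρ l).law σ) := inferInstance
    rw [hd.law_reduce hF ρ ρ l, hd.law_reduce hF ρ σ l] at hle
    rw [hd.law_reduce hF ρ ρ l] at i1
    rw [hd.law_reduce hF ρ σ l] at i2
    obtain ⟨h0, hi, he⟩ := klDiv_withDensity ((hwm l).mul (hpm l)) ((hwm l).mul (hqm l))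
      (fun ω => mul_nonneg (hw0 l ω) (hp0 l ω)) (fun ω => mul_nonneg (hw0 l ω) (hq0 l ω))
      (ne_top_of_le_ne_top hC hle)
    have hfun : (fun ω => (w l ω * p l ω) * Real.log (w l ω * p l ω / (w l ω * q l ω))) =
        fun ω => (∏ k, p k ω) * Real.log (p l ω / q l ω) := by
      funext ω
      rw [← hwp l ω]
      rcases eq_or_ne (w l ω) 0 with h | h
      · simp [h]
      · rw [mul_div_mul_left _ _ h]
    refine ⟨?_, hfun ▸ hi, ?_⟩
    · filter_upwards [h0] with ω hω hqω
      rw [← hwp l ω]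
      exact hω (by simp [hqω])
    · rw [← hfun]
      exact he.trans_le (ENNReal.toReal_mono hC hle)
  have hq_ne : ∀ᵐ ω ∂μ, ∏ k, p k ω ≠ 0 → ∀ l, q l ω ≠ 0 := by
    filter_upwards [ae_all_iff.mpr fun l => (key l).1] with ω hω hne l hl
    exact hne (hω l hl)
  -- The logarithm of the product splits only where all factors are nonzero; where `∏ p k = 0` both
  -- sides vanish.
  have hsum : ∀ᵐ ω ∂μ, (∏ k, p k ω) * Real.log ((∏ k, p k ω) / ∏ k, q k ω) =
      ∑ l, (∏ k, p k ω) * Real.log (p l ω / q l ω) := by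
    filter_upwards [hq_ne] with ω hω
    rcases eq_or_ne (∏ k, p k ω) 0 with h | h
    · simp [h]
    · rw [← Finset.mul_sum, ← Finset.prod_div_distrib, Real.log_prod]
      intro l _
      exact div_ne_zero (Finset.prod_ne_zero_iff.mp h l (Finset.mem_univ l)) (hω h l)
  have hint : Integrable (fun ω => ∑ l, (∏ k, p k ω) * Real.log (p l ω / q l ω)) μ :=
    integrable_finsetSum _ fun l _ => (key l).2.1
  have hbound : ∫ ω, ∑ l, (∏ k, p k ω) * Real.log (p l ω / q l ω) ∂μ ≤
      n * (supMeasuredDiv.{u} ρ σ).toReal := by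
    rw [integral_finsetSum _ fun l _ => (key l).2.1]
    refine (Finset.sum_le_sum fun l _ => (key l).2.2).trans ?_
    simp
  have hpi : Integrable (fun ω => ∏ k, p k ω) μ :=
    hd.integrable_prod_trace hF fun _ => ρ.posSemidef
  have hqi : Integrable (fun ω => ∏ k, q k ω) μ :=
    hd.integrable_prod_trace hF fun _ => σ.posSemidef
  have hlawp : ∀ B, MeasurableSet B →
      (M.law (ρ.tensorPower n)).real B = ∫ ω in B, ∏ k, p k ω ∂μ := fun B hB => by
    rw [M.law_real_apply _ hB]
    exact hd.trace_tensor_mul hF (fun _ => ρ.posSemidef) hB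
  have hlawq : ∀ B, MeasurableSet B →
      (M.law (σ.tensorPower n)).real B = ∫ ω in B, ∏ k, q k ω ∂μ := fun B hB => by
    rw [M.law_real_apply _ hB]
    exact hd.trace_tensor_mul hF (fun _ => σ.posSemidef) hB
  have hset : ∀ (B : Set Ω) (_ : MeasurableSet B) (a : ℝ) (_ : 0 < a),
      (M.law (ρ.tensorPower n)).real B * Real.log a + (M.law (ρ.tensorPower n)).real B -
        a * (M.law (σ.tensorPower n)).real B ≤
        ∫ ω in B, ∑ l, (∏ k, p k ω) * Real.log (p l ω / q l ω) ∂μ := by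
    intro B hB a ha
    have hpB : Integrable (fun ω => ∏ k, p k ω) (μ.restrict B) := hpi.restrict
    have hqB : Integrable (fun ω => ∏ k, q k ω) (μ.restrict B) := hqi.restrict
    have hpa : Integrable (fun ω => (∏ k, p k ω) * Real.log a + ∏ k, p k ω) (μ.restrict B) :=
      (hpB.mul_const _).add hpB
    rw [hlawp B hB, hlawq B hB, ← integral_mul_const, ← integral_const_mul,
      ← integral_add (hpB.mul_const _) hpB, ← integral_sub hpa (hqB.const_mul _)]
    refine integral_mono_ae (hpa.sub (hqB.const_mul _)) hint.restrict
      (ae_restrict_of_ae ?_)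
    filter_upwards [hsum, hq_ne] with ω h1 h2
    rw [← h1]
    refine sub_le_mul_log_div (Finset.prod_nonneg fun k _ => hp0 k ω)
      (Finset.prod_nonneg fun k _ => hq0 k ω) (fun h => ?_) ha
    by_contra hne
    exact Finset.prod_ne_zero_iff.mpr (fun l _ => h2 hne l) h
  -- Slope `c` is used on `A` and slope `1` on the complement, where the bound is `Q(A) - P(A)`; the
  -- two add up to the claim.
  have hA1 := hset A hA c hc
  have hA2 := hset Aᶜ hA.compl 1 one_pos
  have hadd := integral_add_compl hA hint
  rw [probReal_compl_eq_one_sub hA, probReal_compl_eq_one_sub hA, Real.log_one] at hA2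
  linarith

theorem POVM.IsSeparable.neg_log_le {M : POVM Ω (Fin n → d)} (hM : M.IsSeparable)
    (ρ σ : DensityMatrix d) (hC : supMeasuredDiv.{u} ρ σ ≠ ∞) {A : Set Ω} (hA : MeasurableSet A)
    (ha : 0 < (M.law (ρ.tensorPower n)).real A) :
    0 < (M.law (σ.tensorPower n)).real A ∧
      (M.law (ρ.tensorPower n)).real A * -Real.log ((M.law (σ.tensorPower n)).real A) ≤
        n * (supMeasuredDiv.{u} ρ σ).toReal + 1 := by
  exact neg_log_le_of_forall_mul_log_le ha measureReal_nonneg fun c hc =>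
    hM.mul_log_le ρ σ hC hA hc

end Converse

/-! ### The exponent bound from weak consistency -/

section Consistent

variable {d : Type v} [Fintype d] [DecidableEq d] {Θ : Set ℝ} {ρ : ℝ → DensityMatrix d}
  {E : (n : ℕ) → Estimator.{u} d n} {θ θ₁ ε : ℝ}

theorem Estimator.measurableSet_tail {n : ℕ} (F : Estimator.{u} d n) (θ ε : ℝ) :
    MeasurableSet {ω | ε < |F.est ω - θ|} :=
  measurableSet_lt measurable_const (F.measurable_est.sub_const θ).abs

/-- In a consistent sequence, the estimate is eventually far from `θ₁` when the true parameter is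
`θ ≠ θ₁`. -/
theorem WeaklyConsistent.tendsto_real_tail (hE : WeaklyConsistent Θ ρ E) (hθ : θ ∈ Θ)
    (hε : ε < |θ - θ₁|) :
    Tendsto (fun n => ((E n).povm.law ((ρ θ).tensorPower n)).real {ω | ε < |(E n).est ω - θ₁|})
      atTop (𝓝 1) := by
  -- With half the slack as radius, an estimate that close to `θ` stays at distance at least `(|θ -
  -- θ₁| + ε) / 2 > ε` from `θ₁`.
  have h := hE θ hθ ((|θ - θ₁| - ε) / 2) (by linarith)
  have h1 : Tendsto (fun n => 1 - ((E n).tailProb (ρ θ) θ ((|θ - θ₁| - ε) / 2)).toReal) atTop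
      (𝓝 1) := by
    simpa using (ENNReal.tendsto_toReal ENNReal.zero_ne_top |>.comp h).const_sub 1
  refine tendsto_of_tendsto_of_tendsto_of_le_of_le h1 tendsto_const_nhds (fun n => ?_)
    fun n => measureReal_le_one
  change 1 - ((E n).povm.law ((ρ θ).tensorPower n)).real
    {ω | (|θ - θ₁| - ε) / 2 < |(E n).est ω - θ|} ≤ _
  rw [← probReal_compl_eq_one_sub ((E n).measurableSet_tail _ _)]
  refine measureReal_mono fun ω hω => ?_
  have h2 : |(E n).est ω - θ| ≤ (|θ - θ₁| - ε) / 2 := not_lt.mp hω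
  have h3 : |θ - θ₁| ≤ |(E n).est ω - θ₁| + |(E n).est ω - θ| := by
    have := abs_sub_le θ ((E n).est ω) θ₁
    rw [abs_sub_comm θ ((E n).est ω)] at this
    linarith
  change ε < |(E n).est ω - θ₁|
  linarith

/-- The converse gives `-(1/n) log Q(A) ≤ (C + 1/n) / P(A)`, and `P(A) → 1` by consistency. -/
theorem beta_le_supMeasuredDiv (hsep : ∀ n, (E n).povm.IsSeparable)
    (hE : WeaklyConsistent Θ ρ E) (hθ : θ ∈ Θ) (hε : ε < |θ - θ₁|) :
    beta ρ E θ₁ ε ≤ (supMeasuredDiv.{u} (ρ θ) (ρ θ₁) : EReal) := by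
  by_cases hC : supMeasuredDiv.{u} (ρ θ) (ρ θ₁) = ∞
  · simp [hC]
  set C := supMeasuredDiv.{u} (ρ θ) (ρ θ₁) with hCdef
  have ha := hE.tendsto_real_tail (θ₁ := θ₁) hθ hε
  set a : ℕ → ℝ := fun n =>
    ((E n).povm.law ((ρ θ).tensorPower n)).real {ω | ε < |(E n).est ω - θ₁|} with had
  have hu : Tendsto (fun n : ℕ => (C.toReal + 1 / (n : ℝ)) / a n) atTop (𝓝 C.toReal) := by
    have h := (tendsto_const_nhds (x := C.toReal)).add (tendsto_one_div_atTop_nhds_zero_nat (𝕜 := ℝ))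
    rw [add_zero] at h
    have h' := h.div ha one_ne_zero
    rwa [div_one] at h'
  have hu' : Tendsto (fun n : ℕ => (((C.toReal + 1 / (n : ℝ)) / a n : ℝ) : EReal)) atTop
      (𝓝 (C.toReal : EReal)) := (continuous_coe_real_ereal.tendsto _).comp hu
  have hCe : (C : EReal) = (C.toReal : EReal) := (EReal.coe_ennreal_toReal hC).symm
  rw [hCe, ← hu'.limsup_eq]
  refine limsup_le_limsup ?_
  filter_upwards [eventually_gt_atTop 0, ha.eventually (lt_mem_nhds one_pos)] with n hn han
  have hn' : (0 : ℝ) < n := by exact_mod_cast hn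
  obtain ⟨hb, hle⟩ := (hsep n).neg_log_le (ρ θ) (ρ θ₁) hC ((E n).measurableSet_tail θ₁ ε) han
  have htail : (E n).tailProb (ρ θ₁) θ₁ ε = ENNReal.ofReal
      (((E n).povm.law ((ρ θ₁).tensorPower n)).real {ω | ε < |(E n).est ω - θ₁|}) := by
    rw [ofReal_measureReal]
    rfl
  rw [htail, ENNReal.log_ofReal_of_pos hb, ← EReal.coe_neg, ← EReal.coe_div, EReal.coe_le_coe_iff,
    div_le_div_iff₀ hn' han]
  have h1 : (C.toReal + 1 / (n : ℝ)) * n = n * C.toReal + 1 := by field_simp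
  rw [h1, mul_comm]
  exact hle

theorem beta_le_iInf (hsep : ∀ n, (E n).povm.IsSeparable) (hE : WeaklyConsistent Θ ρ E) :
    beta ρ E θ₁ ε ≤ ((⨅ θ ∈ {θ ∈ Θ | ε < |θ - θ₁|},
      supMeasuredDiv.{u} (ρ θ) (ρ θ₁) : ℝ≥0∞) : EReal) := by
  -- The infimum lives in `ℝ≥0∞`, so the bound passes through `toENNReal`, using `x ≤ max 0 x`.
  refine ((le_max_right 0 _).trans_eq EReal.coe_toENNReal_eq_max.symm).trans
    (EReal.coe_ennreal_le_coe_ennreal_iff.mpr ?_)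
  refine le_iInf₂ fun θ hθ => ?_
  rw [← EReal.toENNReal_coe (x := supMeasuredDiv.{u} (ρ θ) (ρ θ₁))]
  exact EReal.toENNReal_le_toENNReal (beta_le_supMeasuredDiv hsep hE hθ.1 hθ.2)

end Consistent

/-! ### Divergence bounded by a chi-square quantity -/

section ChiSquare

/-- The difference of the two sides vanishes at `1`. Its derivative `(y - 1) / m - log y` has the
sign of `y - 1` on `[m, ∞)`, up to zeros, so `1` is a minimum. -/
theorem klFun_le_sq_div {m x : ℝ} (hm : 0 < m) (hm1 : m ≤ 1) (hx : m ≤ x) :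
    InformationTheory.klFun x ≤ (x - 1) ^ 2 / (2 * m) := by
  set f : ℝ → ℝ := fun y => (y - 1) ^ 2 / (2 * m) - InformationTheory.klFun y with hf
  have hd : ∀ y, 0 < y → HasDerivAt f ((y - 1) / m - Real.log y) y := fun y hy => by
    have h1 : HasDerivAt (fun y : ℝ => (y - 1) ^ 2 / (2 * m)) ((y - 1) / m) y := by
      convert! (((hasDerivAt_id y).sub_const 1).pow 2).div_const (2 * m) using 1
      simp
      field_simp
    exact h1.sub (InformationTheory.hasDerivAt_klFun hy.ne')
  have hf1 : f 1 = 0 := by simp [hf, InformationTheory.klFun_one]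
  suffices 0 ≤ f x by simpa [hf] using this
  rw [← hf1]
  rcases le_total 1 x with h1 | h1
  · refine monotoneOn_of_deriv_nonneg (convex_Ici 1) (fun y hy => ?_) (fun y hy => ?_)
      (fun y hy => ?_) (Set.self_mem_Ici) (Set.mem_Ici.mpr h1) h1
    · exact (hd y (one_pos.trans_le hy)).continuousAt.continuousWithinAt
    · rw [interior_Ici] at hy
      exact (hd y (one_pos.trans hy)).differentiableAt.differentiableWithinAt
    · rw [interior_Ici] at hy
      have hy : 1 < y := hy
      rw [(hd y (one_pos.trans hy)).deriv, sub_nonneg]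
      refine (Real.log_le_sub_one_of_pos (one_pos.trans hy)).trans ?_
      rw [le_div_iff₀ hm]
      nlinarith
  · refine antitoneOn_of_deriv_nonpos (convex_Icc m 1) (fun y hy => ?_) (fun y hy => ?_)
      (fun y hy => ?_) ⟨hx, h1⟩ ⟨hm1, le_rfl⟩ h1
    · exact (hd y (hm.trans_le hy.1)).continuousAt.continuousWithinAt
    · rw [interior_Icc] at hy
      exact (hd y (hm.trans hy.1)).differentiableAt.differentiableWithinAt
    · rw [interior_Icc] at hy
      have hy0 : 0 < y := hm.trans hy.1
      rw [(hd y hy0).deriv, sub_nonpos, ← neg_le_neg_iff, ← Real.log_inv]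
      refine (Real.log_le_sub_one_of_pos (inv_pos.mpr hy0)).trans ?_
      rw [← neg_div, neg_sub, inv_eq_one_div, div_sub_one hy0.ne']
      exact div_le_div_of_nonneg_left (by linarith [hy.2]) hm hy.1.le

variable {Ω : Type u} [MeasurableSpace Ω]

/-- If `2 s (P - Q) ≤ s² κ + Q` setwise for all `s` and `m Q ≤ P`, then the divergence of `P` from
`Q` is at most `κ(Ω) / (2 m)`. -/
theorem klDiv_le_of_forall_mul_sub_le {P Q κ : Measure Ω} [IsProbabilityMeasure P]
    [IsProbabilityMeasure Q] [IsFiniteMeasure κ] {m : ℝ} (hm : 0 < m) (hm1 : m ≤ 1)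
    (hac : P ≪ Q) (hPQ : ∀ B, MeasurableSet B → m * Q.real B ≤ P.real B)
    (hκ : ∀ B, MeasurableSet B → ∀ s : ℝ,
      2 * s * (P.real B - Q.real B) ≤ s ^ 2 * κ.real B + Q.real B) :
    InformationTheory.klDiv P Q ≤ ENNReal.ofReal (κ.real Set.univ / (2 * m)) := by
  set g : Ω → ℝ := fun ω => (P.rnDeriv Q ω).toReal with hg
  set k : Ω → ℝ := fun ω => (κ.rnDeriv Q ω).toReal with hk
  have hgi : Integrable g Q := Measure.integrable_toReal_rnDeriv
  have hki : Integrable k Q := Measure.integrable_toReal_rnDeriv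
  have hgB : ∀ B, ∫ ω in B, g ω ∂Q = P.real B := fun B =>
    Measure.setIntegral_toReal_rnDeriv hac B
  have hgm : ∀ᵐ ω ∂Q, m ≤ g ω := by
    have : 0 ≤ᵐ[Q] fun ω => g ω - m := by
      refine ae_nonneg_of_forall_setIntegral_nonneg (hgi.sub (integrable_const m)) fun B hB _ => ?_
      rw [integral_sub hgi.restrict (integrable_const m), hgB, setIntegral_const, smul_eq_mul,
        mul_comm]
      linarith [hPQ B hB]
    filter_upwards [this] with ω hω
    simpa using hω
  -- outside a `Q`-null set, `κ` has density `k`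
  obtain ⟨S, hS, hS1, hS2⟩ := Measure.mutuallySingular_singularPart κ Q
  have hkB : ∀ B, MeasurableSet B → κ.real (B ∩ S) ≤ ∫ ω in B, k ω ∂Q := by
    intro B hB
    have h1 : κ (B ∩ S) = ∫⁻ ω in B ∩ S, κ.rnDeriv Q ω ∂Q := by
      conv_lhs => rw [Measure.haveLebesgueDecomposition_add κ Q]
      rw [Measure.add_apply, measure_mono_null Set.inter_subset_right hS1, zero_add,
        withDensity_apply _ (hB.inter hS)]
    rw [measureReal_def, h1, ← integral_toReal (Measure.measurable_rnDeriv κ Q).aemeasurable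
      (ae_restrict_of_ae (Measure.rnDeriv_lt_top κ Q))]
    exact setIntegral_mono_set hki.restrict (ae_of_all _ fun _ => ENNReal.toReal_nonneg)
      (LE.le.eventuallyLE Set.inter_subset_left)
  have hS' : ∀ B, Q (B \ (B ∩ S)) = 0 := fun B =>
    measure_mono_null (fun ω hω hS => hω.2 ⟨hω.1, hS⟩) hS2
  have hQS : ∀ B, Q.real (B ∩ S) = Q.real B := fun B => by
    rw [measureReal_def, measureReal_def, measure_eq_measure_of_null_sdiff Set.inter_subset_left
      (hS' B)]
  have hPS : ∀ B, P.real (B ∩ S) = P.real B := fun B => by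
    rw [measureReal_def, measureReal_def, measure_eq_measure_of_null_sdiff Set.inter_subset_left
      (hac (hS' B))]
  have hquad : ∀ s : ℝ, ∀ᵐ ω ∂Q, 0 ≤ s ^ 2 * k ω + 1 - 2 * s * (g ω - 1) := by
    intro s
    have i1 : Integrable (fun ω => s ^ 2 * k ω + 1) Q :=
      (hki.const_mul _).add (integrable_const _)
    have i2 : Integrable (fun ω => 2 * s * (g ω - 1)) Q :=
      (hgi.sub (integrable_const _)).const_mul _
    refine ae_nonneg_of_forall_setIntegral_nonneg (i1.sub i2) fun B hB _ => ?_
    rw [integral_sub i1.restrict i2.restrict, integral_add (hki.restrict.const_mul _)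
      (integrable_const _), integral_const_mul, integral_const_mul,
      integral_sub hgi.restrict (integrable_const _), hgB, setIntegral_const, smul_eq_mul, mul_one]
    have h1 := hκ (B ∩ S) (hB.inter hS) s
    rw [hQS, hPS] at h1
    have h2 := mul_le_mul_of_nonneg_left (hkB B hB) (sq_nonneg s)
    linarith
  have hsq : ∀ᵐ ω ∂Q, (g ω - 1) ^ 2 ≤ k ω := by
    -- Rational `s` keep the exceptional set null; continuity in `s` then gives all real `s`.
    filter_upwards [ae_all_iff.mpr fun s : ℚ => hquad s] with ω hω
    have hall : ∀ s : ℝ, 0 ≤ s ^ 2 * k ω + 1 - 2 * s * (g ω - 1) := by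
      have hcl : IsClosed {s : ℝ | 0 ≤ s ^ 2 * k ω + 1 - 2 * s * (g ω - 1)} :=
        isClosed_le continuous_const (by fun_prop)
      intro s
      exact hcl.closure_subset_iff.mpr (Set.range_subset_iff.mpr hω)
        (Rat.denseRange_cast (𝕜 := ℝ) s)
    -- A quadratic in `s` that is nowhere negative has discriminant `4 (g - 1)² - 4 k ≤ 0`.
    have := discrim_le_zero (a := k ω) (b := -(2 * (g ω - 1))) (c := 1) fun s => by
      linarith [hall s]
    rw [discrim] at this
    linarith
  rw [InformationTheory.klDiv_eq_lintegral_klFun_of_ac hac]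
  have hle : ∀ᵐ ω ∂Q, ENNReal.ofReal (InformationTheory.klFun (P.rnDeriv Q ω).toReal) ≤
      ENNReal.ofReal (k ω / (2 * m)) := by
    filter_upwards [hgm, hsq] with ω h1 h2
    refine ENNReal.ofReal_le_ofReal ((klFun_le_sq_div hm hm1 h1).trans ?_)
    gcongr
  refine (lintegral_mono_ae hle).trans ?_
  rw [← ofReal_integral_eq_lintegral_ofReal (hki.div_const _)
    (ae_of_all _ fun ω => div_nonneg ENNReal.toReal_nonneg (by positivity)), integral_div]
  refine ENNReal.ofReal_le_ofReal ?_
  gcongr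
  rw [Measure.integral_toReal_rnDeriv']
  linarith [measureReal_nonneg (μ := κ.singularPart Q) (s := Set.univ)]

end ChiSquare

/-! ### Domination of Hermitian matrices by a positive matrix -/

section MatrixBounds

variable {d : Type v} [Fintype d] [DecidableEq d]

/-- The sum of the entry norms bounds the quadratic form, since `‖x i‖ ‖x j‖ ≤ ∑ k, ‖x k‖²`. -/
theorem smul_one_sub_posSemidef_of_isHermitian {R : Matrix d d ℂ} (hR : R.IsHermitian) :
    (((∑ i, ∑ j, ‖R i j‖ : ℝ) : ℂ) • (1 : Matrix d d ℂ) - R).PosSemidef := by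
  set r : ℝ := ∑ i, ∑ j, ‖R i j‖ with hr
  have hH : ((r : ℂ) • (1 : Matrix d d ℂ) - R).IsHermitian := by
    refine Matrix.IsHermitian.sub ?_ hR
    rw [Matrix.IsHermitian, Matrix.conjTranspose_smul, Matrix.conjTranspose_one]
    simp
  refine Matrix.PosSemidef.of_dotProduct_mulVec_nonneg hH fun x => ?_
  have him := hH.im_star_dotProduct_mulVec_self x
  refine Complex.nonneg_iff.mpr ⟨?_, him.symm⟩
  set X : ℝ := ∑ k, ‖x k‖ ^ 2 with hX
  have hxx : star x ⬝ᵥ x = (X : ℂ) := by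
    simp [hX, dotProduct, ← Complex.normSq_eq_conj_mul_self, Complex.normSq_eq_norm_sq]
  rw [Matrix.sub_mulVec, dotProduct_sub, Matrix.smul_mulVec, Matrix.one_mulVec, dotProduct_smul,
    hxx, smul_eq_mul, ← Complex.ofReal_mul, Complex.sub_re, Complex.ofReal_re, sub_nonneg]
  refine (Complex.re_le_norm _).trans ?_
  simp only [dotProduct, Matrix.mulVec, Finset.mul_sum]
  refine (norm_sum_le _ _).trans ?_
  rw [hr, Finset.sum_mul]
  refine Finset.sum_le_sum fun i _ => (norm_sum_le _ _).trans ?_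
  rw [Finset.sum_mul]
  refine Finset.sum_le_sum fun j _ => ?_
  rw [norm_mul, norm_mul, Pi.star_apply, norm_star, ← mul_assoc, mul_comm ‖x i‖, mul_assoc]
  refine mul_le_mul_of_nonneg_left ?_ (norm_nonneg _)
  have h : ∀ k, ‖x k‖ ^ 2 ≤ X := fun k =>
    Finset.single_le_sum (f := fun k => ‖x k‖ ^ 2) (fun _ _ => sq_nonneg _) (Finset.mem_univ k)
  nlinarith [h i, h j, sq_nonneg (‖x i‖ - ‖x j‖)]

/-- Every square matrix over a field has a generalized inverse. -/
theorem exists_mul_mul_eq_self (C : Matrix d d ℂ) : ∃ B : Matrix d d ℂ, C * B * C = C := by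
  obtain ⟨g, hg⟩ := (Matrix.toLin' C).rangeRestrict.exists_rightInverse_of_surjective
    (LinearMap.range_rangeRestrict _)
  obtain ⟨f, hf⟩ := LinearMap.exists_extend g
  refine ⟨LinearMap.toMatrix' f, Matrix.toLin'.injective ?_⟩
  rw [Matrix.toLin'_mul, Matrix.toLin'_mul, Matrix.toLin'_toMatrix']
  refine LinearMap.ext fun x => ?_
  have h1 : f (Matrix.toLin' C x) = g ((Matrix.toLin' C).rangeRestrict x) :=
    LinearMap.congr_fun hf ((Matrix.toLin' C).rangeRestrict x)
  have h2 := congrArg Subtype.val (LinearMap.congr_fun hg ((Matrix.toLin' C).rangeRestrict x))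
  simp only [LinearMap.comp_apply] at h2 ⊢
  rw [h1]
  exact h2

/-- A Hermitian matrix `R` that vanishes on the kernel of `σ ≥ 0` is dominated by a multiple of
`σ`, with a constant proportional to the size of `R`. -/
theorem exists_smul_sub_posSemidef {σ : Matrix d d ℂ} (hσ : σ.PosSemidef) :
    ∃ c : ℝ, 0 ≤ c ∧ ∀ R : Matrix d d ℂ, R.IsHermitian →
      (∀ x : d → ℂ, σ.mulVec x = 0 → R.mulVec x = 0) →
      (((c * ∑ i, ∑ j, ‖R i j‖ : ℝ) : ℂ) • σ - R).PosSemidef := by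
  obtain ⟨C, hC⟩ : ∃ C : Matrix d d ℂ, σ = C.conjTranspose * C := by
    open scoped MatrixOrder Matrix.Norms.L2Operator in
    obtain ⟨C, hC⟩ := CStarAlgebra.nonneg_iff_eq_star_mul_self.mp hσ.nonneg
    exact ⟨C, hC⟩
  obtain ⟨B, hB⟩ := exists_mul_mul_eq_self C
  set b : ℝ := ∑ i, ∑ j, ‖(B.conjTranspose * B) i j‖
  refine ⟨b, by positivity, fun R hR hker => ?_⟩
  set r : ℝ := ∑ i, ∑ j, ‖R i j‖
  -- As `C B C = C`, the range of `1 - B C` lies in `ker C`, hence in `ker σ`, where `R` vanishes.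
  have h1 : R * (B * C) = R := by
    suffices h : R * (1 - B * C) = 0 by
      rw [Matrix.mul_sub, Matrix.mul_one, sub_eq_zero] at h
      exact h.symm
    refine Matrix.ext_of_mulVec_single fun i => ?_
    rw [← Matrix.mulVec_mulVec, Matrix.zero_mulVec]
    refine hker _ ?_
    rw [Matrix.mulVec_mulVec, hC]
    have : C * (1 - B * C) = 0 := by rw [Matrix.mul_sub, ← Matrix.mul_assoc, hB]; simp
    rw [Matrix.mul_assoc, this, Matrix.mul_zero, Matrix.zero_mulVec]
  have h2 : (B * C).conjTranspose * R * (B * C) = R := by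
    rw [Matrix.mul_assoc, h1]
    have := congrArg Matrix.conjTranspose h1
    rwa [Matrix.conjTranspose_mul, hR.eq] at this
  -- The two bounds chain as `R ≤ r (B C)ᴴ (B C)` and `Cᴴ (Bᴴ B) C ≤ b Cᴴ C = b σ`.
  have p1 := (smul_one_sub_posSemidef_of_isHermitian hR).conjTranspose_mul_mul_same (B * C)
  have p2 := (smul_one_sub_posSemidef_of_isHermitian
    (Matrix.isHermitian_conjTranspose_mul_self B)).conjTranspose_mul_mul_same C
  have hr : 0 ≤ (r : ℂ) := by exact_mod_cast (by positivity : 0 ≤ r)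
  convert! p1.add (p2.smul hr) using 1
  rw [Matrix.mul_sub, Matrix.sub_mul, h2, Matrix.mul_sub, Matrix.sub_mul, Matrix.conjTranspose_mul]
  simp only [Matrix.mul_smul, Matrix.smul_mul, Matrix.mul_one, smul_sub, smul_smul,
    Matrix.mul_assoc]
  rw [← hC, mul_comm b r, Complex.ofReal_mul]
  abel

theorem exists_abs_trace_mul_le {σ : Matrix d d ℂ} (hσ : σ.PosSemidef) :
    ∃ c : ℝ, 0 ≤ c ∧ ∀ R : Matrix d d ℂ, R.IsHermitian →
      (∀ x : d → ℂ, σ.mulVec x = 0 → R.mulVec x = 0) → ∀ M : Matrix d d ℂ, M.PosSemidef →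
      |(R * M).trace.re| ≤ (c * ∑ i, ∑ j, ‖R i j‖) * (σ * M).trace.re := by
  obtain ⟨c, hc, h⟩ := exists_smul_sub_posSemidef hσ
  refine ⟨c, hc, fun R hR hker M hM => ?_⟩
  have h1 := trace_mul_re_nonneg (h R hR hker) hM
  have h2 := trace_mul_re_nonneg (h (-R) hR.neg fun x hx => by
    rw [Matrix.neg_mulVec, hker x hx, neg_zero]) hM
  simp only [Matrix.sub_mul, Matrix.smul_mul, Matrix.trace_sub, Matrix.trace_smul, smul_eq_mul,
    Complex.sub_re, Complex.re_ofReal_mul, Matrix.neg_apply, norm_neg, Matrix.neg_mul,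
    Matrix.trace_neg, Complex.neg_re] at h1 h2
  exact abs_le.mpr ⟨by linarith, by linarith⟩

end MatrixBounds

/-! ### From matrix inequalities to measured divergences -/

section QuadraticBound

variable {d : Type v} [Fintype d] [DecidableEq d]

theorem POVM.exists_measure_trace_mul {Ω : Type u} [MeasurableSpace Ω] (M : POVM Ω d)
    {K : Matrix d d ℂ} (hK : K.PosSemidef) :
    ∃ κ : Measure Ω, IsFiniteMeasure κ ∧ ∀ B, MeasurableSet B →
      κ.real B = (K * M.toVectorMeasure B).trace.re := by
  rcases hK.trace_nonneg.eq_or_lt with h | h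
  · have : K = 0 := hK.trace_eq_zero_iff.mp h.symm
    exact ⟨0, inferInstance, fun B _ => by simp [this]⟩
  · obtain ⟨τ, hτ⟩ : ∃ τ : ℝ, (τ : ℂ) = K.trace := ⟨K.trace.re, by
      have := (Complex.nonneg_iff.mp hK.trace_nonneg).2
      exact Complex.ext rfl (by simpa using this)⟩
    rw [← hτ] at h
    have hτ0 : 0 < τ := by exact_mod_cast h
    have hinv : 0 ≤ ((τ : ℂ))⁻¹ := by exact_mod_cast (inv_pos.mpr hτ0).le
    let k : DensityMatrix d :=
      { toMatrix := ((τ : ℂ))⁻¹ • K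
        posSemidef := hK.smul hinv
        trace_eq_one := by
          rw [Matrix.trace_smul, ← hτ, smul_eq_mul, inv_mul_cancel₀ h.ne'] }
    refine ⟨ENNReal.ofReal τ • M.law k, Measure.smul_finite _ ENNReal.ofReal_ne_top,
      fun B hB => ?_⟩
    rw [measureReal_ennreal_smul_apply, M.law_real_apply k hB, ENNReal.toReal_ofReal hτ0.le]
    change τ * (((τ : ℂ))⁻¹ • K * M.toVectorMeasure B).trace.re = _
    rw [Matrix.smul_mul, Matrix.trace_smul, smul_eq_mul, ← Complex.ofReal_inv,
      Complex.re_ofReal_mul, mul_inv_cancel_left₀ hτ0.ne']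

/-- Inserting `M(B)` for the test matrix turns the hypotheses into the setwise chi-square conditions
with `κ(B) = Tr K M(B)`. The resulting bound involves only `κ(Ω) = Tr K`, so it is uniform over
POVMs. -/
theorem supMeasuredDiv_le {ρ σ : DensityMatrix d} {K : Matrix d d ℂ} (hK : K.PosSemidef) {m : ℝ}
    (hm : 0 < m) (hm1 : m ≤ 1)
    (hl : ∀ M : Matrix d d ℂ, M.PosSemidef →
      m * (σ.toMatrix * M).trace.re ≤ (ρ.toMatrix * M).trace.re)
    (hq : ∀ M : Matrix d d ℂ, M.PosSemidef → ∀ s : ℝ,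
      2 * s * ((ρ.toMatrix * M).trace.re - (σ.toMatrix * M).trace.re) ≤
        s ^ 2 * (K * M).trace.re + (σ.toMatrix * M).trace.re) :
    supMeasuredDiv.{u} ρ σ ≤ ENNReal.ofReal (K.trace.re / (2 * m)) := by
  refine iSup_le fun Ω => iSup_le fun _ => iSup_le fun M => ?_
  obtain ⟨κ, _, hκ⟩ := M.exists_measure_trace_mul hK
  have hac : M.law ρ ≪ M.law σ := by
    refine Measure.AbsolutelyContinuous.mk fun B hB h => ?_
    rw [← measureReal_eq_zero_iff, M.law_real_apply σ hB] at h
    rw [← measureReal_eq_zero_iff, M.law_real_apply ρ hB]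
    have hB' := M.posSemidef B hB
    set p := (ρ.toMatrix * M.toVectorMeasure B).trace.re with hp
    have hp0 : 0 ≤ p := trace_mul_re_nonneg ρ.posSemidef hB'
    have hk0 := trace_mul_re_nonneg hK hB'
    -- When `Tr σ M(B) = 0`, the quadratic inequality for small `s` forces `p = 0`; the `+ 1` keeps
    -- the denominator positive.
    have h1 := hq _ hB' (p / ((K * M.toVectorMeasure B).trace.re + 1))
    rw [h] at h1
    set k := (K * M.toVectorMeasure B).trace.re
    have e : (p / (k + 1)) ^ 2 * k + 0 - 2 * (p / (k + 1)) * (p - 0) =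
      -(p ^ 2 * (k + 2) / (k + 1) ^ 2) := by field_simp; ring
    have h2 : p ^ 2 * (k + 2) / (k + 1) ^ 2 ≤ 0 := by linarith
    by_contra hne
    have : 0 < p := hp0.lt_of_ne (Ne.symm hne)
    have : 0 < p ^ 2 * (k + 2) / (k + 1) ^ 2 := by positivity
    linarith
  have h := klDiv_le_of_forall_mul_sub_le (P := M.law ρ) (Q := M.law σ) (κ := κ) hm hm1 hac
    (fun B hB => by
      rw [M.law_real_apply ρ hB, M.law_real_apply σ hB]
      exact hl _ (M.posSemidef B hB))
    (fun B hB s => by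
      rw [M.law_real_apply ρ hB, M.law_real_apply σ hB, hκ B hB]
      exact hq _ (M.posSemidef B hB) s)
  rwa [hκ _ MeasurableSet.univ, M.univ_eq_one, mul_one] at h

/-- Expand `0 ≤ Tr (1 - u L) σ (1 - u L)ᴴ M`. This is the Cauchy–Schwarz step behind the SLD bound
on classical Fisher information, in a form without division by probabilities. -/
theorem two_mul_mul_trace_le {σ L M : Matrix d d ℂ} (hσ : σ.PosSemidef) (hL : L.IsHermitian)
    (hM : M.PosSemidef) (u : ℝ) :
    2 * u * ((((1 : ℂ) / 2) • (L * σ + σ * L)) * M).trace.re ≤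
      u ^ 2 * (L * σ * L * M).trace.re + (σ * M).trace.re := by
  have h := trace_mul_re_nonneg (hσ.mul_mul_conjTranspose_same (1 - (u : ℂ) • L)) hM
  have e : (1 - (u : ℂ) • L) * σ * (1 - (u : ℂ) • L).conjTranspose * M =
      σ * M - ((2 * u : ℝ) : ℂ) • ((((1 : ℂ) / 2) • (L * σ + σ * L)) * M) +
        ((u ^ 2 : ℝ) : ℂ) • (L * σ * L * M) := by
    rw [Matrix.conjTranspose_sub, Matrix.conjTranspose_one, Matrix.conjTranspose_smul, hL.eq]
    simp only [Complex.star_def, Complex.conj_ofReal, Matrix.sub_mul, Matrix.mul_sub,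
      Matrix.one_mul, Matrix.mul_one, Matrix.smul_mul, Matrix.mul_smul, Matrix.add_mul, smul_smul,
      smul_add, smul_sub]
    push_cast
    rw [show (2 * (u : ℂ) * (1 / 2)) = u by ring, pow_two]
    abel
  rw [e, Matrix.trace_add, Matrix.trace_sub, Matrix.trace_smul, Matrix.trace_smul, smul_eq_mul,
    smul_eq_mul, Complex.add_re, Complex.sub_re, Complex.re_ofReal_mul, Complex.re_ofReal_mul] at h
  linarith

/-- Young's inequality with weight `η`: the budget `q` is split into `q / (1 + η)` for the main term
and `η q / (1 + η)` for the remainder. -/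
theorem two_mul_mul_add_le {η t c s q ν κ r : ℝ} (hη : 0 < η) (hq : 0 ≤ q)
    (hν : ∀ u : ℝ, 2 * u * ν ≤ u ^ 2 * κ + q) (hr : |r| ≤ c * q) :
    2 * s * (t * ν + r) ≤ s ^ 2 * ((1 + η) * t ^ 2 * κ + (1 + 1 / η) * c ^ 2 * q) + q := by
  have h1 := hν ((1 + η) * s * t)
  have h2 : 2 * s * t * ν ≤ q / (1 + η) + (1 + η) * s ^ 2 * t ^ 2 * κ := by
    have e : q / (1 + η) + (1 + η) * s ^ 2 * t ^ 2 * κ - 2 * s * t * ν =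
      (((1 + η) * s * t) ^ 2 * κ + q - 2 * ((1 + η) * s * t) * ν) / (1 + η) := by
      field_simp; ring
    have : 0 ≤ (((1 + η) * s * t) ^ 2 * κ + q - 2 * ((1 + η) * s * t) * ν) / (1 + η) :=
      div_nonneg (by linarith) (by linarith)
    linarith
  have h3 : 2 * s * r ≤ 2 * (|s| * c) * q := by
    have : s * r ≤ |s| * (c * q) :=
      (le_abs_self _).trans (by rw [abs_mul]; exact mul_le_mul_of_nonneg_left hr (abs_nonneg _))
    linarith
  have h4 : 2 * (|s| * c) ≤ (1 + 1 / η) * (s ^ 2 * c ^ 2) + η / (1 + η) := by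
    have e : (1 + 1 / η) * (s ^ 2 * c ^ 2) + η / (1 + η) - 2 * (|s| * c) =
      ((1 + η) * (|s| * c) - η) ^ 2 / (η * (1 + η)) := by
      rw [← sq_abs s]; field_simp; ring
    have : 0 ≤ ((1 + η) * (|s| * c) - η) ^ 2 / (η * (1 + η)) := by positivity
    linarith
  have h5 := mul_le_mul_of_nonneg_right h4 hq
  have e : q / (1 + η) + η / (1 + η) * q = q := by field_simp
  linarith

end QuadraticBound

/-! ### Local expansion at `θ₁` and the bound on `α` -/

section LocalBound

variable {d : Type v} [Fintype d] {S : Set ℝ} {ρ : ℝ → DensityMatrix d} {θ₁ : ℝ}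
  {L : Matrix d d ℂ}

/-- The derivative of a family of states vanishes on a common kernel. -/
theorem IsSLD.mulVec_eq_zero (hL : IsSLD S ρ θ₁ L) (hS : UniqueDiffWithinAt ℝ S θ₁)
    (hker : ∀ᶠ θ in 𝓝[S] θ₁, ∀ x : d → ℂ,
      (ρ θ₁).toMatrix.mulVec x = 0 → (ρ θ).toMatrix.mulVec x = 0)
    {x : d → ℂ} (hx : (ρ θ₁).toMatrix.mulVec x = 0) :
    (((1 : ℂ) / 2) • (L * (ρ θ₁).toMatrix + (ρ θ₁).toMatrix * L)).mulVec x = 0 := by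
  funext i
  have h1 : HasDerivWithinAt (fun t => ((ρ t).toMatrix.mulVec x) i)
      ((((1 : ℂ) / 2) • (L * (ρ θ₁).toMatrix + (ρ θ₁).toMatrix * L)).mulVec x i) S θ₁ := by
    simp only [Matrix.mulVec, dotProduct]
    refine HasDerivWithinAt.fun_sum fun j _ => ?_
    have := (hL.2 i j).mul_const (x j)
    rw [Matrix.smul_apply, smul_eq_mul, one_div, inv_mul_eq_div]
    exact this
  have h2 : HasDerivWithinAt (fun t => ((ρ t).toMatrix.mulVec x) i) 0 S θ₁ := by
    refine (hasDerivWithinAt_const θ₁ S (0 : ℂ)).congr_of_eventuallyEq ?_ ?_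
    · filter_upwards [hker] with θ hθ
      rw [hθ x hx, Pi.zero_apply]
    · rw [hx, Pi.zero_apply]
  exact hS.eq_deriv _ h1 h2

theorem sldFisher_eq_trace (σ : DensityMatrix d) (L : Matrix d d ℂ) :
    sldFisher σ L = (L * σ.toMatrix * L).trace.re := by
  rw [sldFisher, Matrix.mul_assoc, Matrix.trace_mul_comm, Matrix.mul_assoc]

variable [DecidableEq d]

/-- Locally, the measured relative entropy is at most half of the SLD Fisher information times the
squared distance of the parameters, up to a relative error. -/
theorem IsSLD.eventually_supMeasuredDiv_le (hL : IsSLD S ρ θ₁ L)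
    (hS : UniqueDiffWithinAt ℝ S θ₁)
    (hker : ∀ᶠ θ in 𝓝[S] θ₁, ∀ x : d → ℂ,
      (ρ θ₁).toMatrix.mulVec x = 0 → (ρ θ).toMatrix.mulVec x = 0)
    {y : ℝ} (hy : sldFisher (ρ θ₁) L / 2 < y) :
    ∀ᶠ θ in 𝓝[S \ {θ₁}] θ₁,
      supMeasuredDiv.{u} (ρ θ) (ρ θ₁) ≤ ENNReal.ofReal (y * (θ - θ₁) ^ 2) := by
  set σ := ρ θ₁ with hσ
  set D : Matrix d d ℂ := ((1 : ℂ) / 2) • (L * σ.toMatrix + σ.toMatrix * L) with hD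
  have hLH : L.IsHermitian := hL.1
  have hDH : D.IsHermitian := by
    rw [hD, Matrix.IsHermitian, Matrix.conjTranspose_smul, Matrix.conjTranspose_add,
      Matrix.conjTranspose_mul, Matrix.conjTranspose_mul, hLH.eq, σ.posSemidef.isHermitian.eq,
      add_comm]
    simp
  have hDker : ∀ x : d → ℂ, σ.toMatrix.mulVec x = 0 → D.mulVec x = 0 := fun x hx =>
    hL.mulVec_eq_zero hS hker hx
  have hLσL : (L * σ.toMatrix * L).PosSemidef := by
    simpa [hLH.eq] using σ.posSemidef.mul_mul_conjTranspose_same L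
  set J := sldFisher σ L with hJ
  have hJ0 : 0 ≤ J := by
    rw [hJ, sldFisher_eq_trace]
    exact (Complex.nonneg_iff.mp hLσL.trace_nonneg).1
  obtain ⟨c, hc, hbound⟩ := exists_abs_trace_mul_le σ.posSemidef
  set Δ : ℝ → Matrix d d ℂ := fun θ => (ρ θ).toMatrix - σ.toMatrix with hΔ
  set R : ℝ → Matrix d d ℂ := fun θ => Δ θ - ((θ - θ₁ : ℝ) : ℂ) • D with hR
  set a : ℝ → ℝ := fun θ => c * ∑ i, ∑ j, ‖Δ θ i j‖ with ha
  set r : ℝ → ℝ := fun θ => c * ∑ i, ∑ j, ‖R θ i j‖ with hr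
  have hDeriv : ∀ i j, HasDerivWithinAt (fun t => (ρ t).toMatrix i j) (D i j) S θ₁ := fun i j => by
    rw [hD, Matrix.smul_apply, smul_eq_mul, one_div, inv_mul_eq_div]
    exact hL.2 i j
  have hmono : 𝓝[S \ {θ₁}] θ₁ ≤ 𝓝[S] θ₁ := nhdsWithin_mono _ Set.sdiff_subset
  have ha0 : Tendsto a (𝓝[S \ {θ₁}] θ₁) (𝓝 0) := by
    have h : ∀ i j, Tendsto (fun θ => ‖Δ θ i j‖) (𝓝[S] θ₁) (𝓝 0) := fun i j => by
      have := ((hDeriv i j).continuousWithinAt.tendsto.sub_const (σ.toMatrix i j)).norm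
      simpa [hΔ, hσ] using this
    have h2 : Tendsto a (𝓝[S] θ₁) (𝓝 (c * ∑ _i : d, ∑ _j : d, 0)) :=
      (tendsto_finsetSum _ fun i _ => tendsto_finsetSum _ fun j _ => h i j).const_mul c
    simpa using h2.mono_left hmono
  have hr0 : Tendsto (fun θ => r θ / (θ - θ₁)) (𝓝[S \ {θ₁}] θ₁) (𝓝 0) := by
    have h : ∀ i j, (fun θ => ‖R θ i j‖) =o[𝓝[S] θ₁] fun θ => θ - θ₁ := fun i j => by
      refine Asymptotics.IsLittleO.norm_left ?_
      have := hasDerivWithinAt_iff_isLittleO.mp (hDeriv i j)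
      simpa [hR, hΔ, hσ] using this
    have h2 : r =o[𝓝[S] θ₁] fun θ => θ - θ₁ :=
      (Asymptotics.IsLittleO.fun_sum fun i _ => Asymptotics.IsLittleO.fun_sum fun j _ => h i j)
        |>.const_mul_left c
    exact (h2.mono hmono).tendsto_div_nhds_zero
  -- choice of the relative error
  set η : ℝ := (y - J / 2) / (J + 1) with hη
  have hη0 : 0 < η := div_pos (by linarith) (by linarith)
  have hηJ : (1 + η) * J / 2 < y := by
    have : η * (J + 1) = y - J / 2 := div_mul_cancel₀ _ (by linarith)
    nlinarith
  have hlim : Tendsto (fun θ => ((1 + η) * J + (1 + 1 / η) * (r θ / (θ - θ₁)) ^ 2) /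
      (2 * (1 - a θ))) (𝓝[S \ {θ₁}] θ₁) (𝓝 ((1 + η) * J / 2)) := by
    have h := ((hr0.pow 2).const_mul (1 + 1 / η)).const_add ((1 + η) * J) |>.div
      ((ha0.const_sub 1).const_mul 2) (by norm_num)
    convert! h using 2
    simp
  filter_upwards [hlim.eventually (gt_mem_nhds hηJ), ha0.eventually (gt_mem_nhds one_pos),
    hmono hker, self_mem_nhdsWithin] with θ hlt ha1 hkerθ hθ
  have hne : θ - θ₁ ≠ 0 := sub_ne_zero.mpr hθ.2
  have hΔH : (Δ θ).IsHermitian := (ρ θ).posSemidef.isHermitian.sub σ.posSemidef.isHermitian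
  have hΔker : ∀ x : d → ℂ, σ.toMatrix.mulVec x = 0 → (Δ θ).mulVec x = 0 := fun x hx => by
    rw [hΔ, Matrix.sub_mulVec, hx, hkerθ x hx, sub_zero]
  have hRH : (R θ).IsHermitian := by
    refine hΔH.sub ?_
    rw [Matrix.IsHermitian, Matrix.conjTranspose_smul, hDH.eq, Complex.star_def,
      Complex.conj_ofReal]
  have hRker : ∀ x : d → ℂ, σ.toMatrix.mulVec x = 0 → (R θ).mulVec x = 0 := fun x hx => by
    rw [hR, Matrix.sub_mulVec, Matrix.smul_mulVec, hDker x hx, hΔker x hx, smul_zero, sub_zero]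
  have ha_nonneg : 0 ≤ a θ := by positivity
  have hη1 : 0 ≤ (1 + 1 / η) := by positivity
  have hk1 : 0 ≤ (((1 + η) * (θ - θ₁) ^ 2 : ℝ) : ℂ) := by exact_mod_cast (by positivity)
  have hk2 : 0 ≤ (((1 + 1 / η) * (r θ) ^ 2 : ℝ) : ℂ) := by exact_mod_cast (by positivity)
  -- The coefficients are those of `two_mul_mul_add_le` with `t = θ - θ₁` and remainder constant `r
  -- θ`, which is `o(θ - θ₁)`.
  set K : Matrix d d ℂ := (((1 + η) * (θ - θ₁) ^ 2 : ℝ) : ℂ) • (L * σ.toMatrix * L) +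
    (((1 + 1 / η) * (r θ) ^ 2 : ℝ) : ℂ) • σ.toMatrix with hKdef
  have hK : K.PosSemidef := (hLσL.smul hk1).add (σ.posSemidef.smul hk2)
  have hsplit : ∀ M : Matrix d d ℂ, ((ρ θ).toMatrix * M).trace.re - (σ.toMatrix * M).trace.re =
      (θ - θ₁) * (D * M).trace.re + (R θ * M).trace.re := fun M => by
    simp only [hR, hΔ, Matrix.sub_mul, Matrix.smul_mul, Matrix.trace_sub, Matrix.trace_smul,
      smul_eq_mul, Complex.sub_re, Complex.re_ofReal_mul]
    ring
  -- The lower bound `m = 1 - a θ` comes from `|Tr Δ M| ≤ a θ * Tr σ M` and tends to `1`.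
  refine (supMeasuredDiv_le hK (m := 1 - a θ) (by linarith) (by linarith) (fun M hM => ?_)
    (fun M hM s => ?_)).trans (ENNReal.ofReal_le_ofReal ?_)
  · have h := (abs_le.mp (hbound (Δ θ) hΔH hΔker M hM)).1
    have e : (Δ θ * M).trace.re = ((ρ θ).toMatrix * M).trace.re - (σ.toMatrix * M).trace.re := by
      simp only [hΔ, Matrix.sub_mul, Matrix.trace_sub, Complex.sub_re]
    rw [e] at h
    change -(a θ * _) ≤ _ at h
    linarith
  · rw [hsplit]
    have e : (K * M).trace.re = (1 + η) * (θ - θ₁) ^ 2 * (L * σ.toMatrix * L * M).trace.re +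
        (1 + 1 / η) * (r θ) ^ 2 * (σ.toMatrix * M).trace.re := by
      simp only [hKdef, Matrix.add_mul, Matrix.smul_mul, Matrix.trace_add, Matrix.trace_smul,
        smul_eq_mul, Complex.add_re, Complex.re_ofReal_mul]
    rw [e]
    exact two_mul_mul_add_le hη0 (trace_mul_re_nonneg σ.posSemidef hM)
      (fun u => two_mul_mul_trace_le σ.posSemidef hLH hM u) (hbound (R θ) hRH hRker M hM)
  · have e : K.trace.re = (1 + η) * (θ - θ₁) ^ 2 * J + (1 + 1 / η) * (r θ) ^ 2 := by
      simp only [hKdef, Matrix.trace_add, Matrix.trace_smul, smul_eq_mul, Complex.add_re,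
        Complex.re_ofReal_mul, σ.trace_eq_one, Complex.ofReal_re, mul_one, hJ, sldFisher_eq_trace]
    have e2 : K.trace.re / (2 * (1 - a θ)) = ((1 + η) * J + (1 + 1 / η) * (r θ / (θ - θ₁)) ^ 2) /
        (2 * (1 - a θ)) * (θ - θ₁) ^ 2 := by
      rw [e, div_mul_eq_mul_div]
      congr 1
      field_simp
    rw [e2]
    exact mul_le_mul_of_nonneg_right hlt.le (sq_nonneg _)

variable {Θ : Set ℝ} {E : (n : ℕ) → Estimator.{u} d n}

/-- The map `φ b` selects the test parameter at distance `b ε` from `θ₁`, so both one-sided cases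
share the argument. Since `β` admits only parameters strictly farther than `ε`, `b` must exceed `1`;
the factor `b²` is absorbed by the gap between `J / 2` and `y`. -/
theorem alpha_le_of_tendsto (hsep : ∀ n, (E n).povm.IsSeparable) (hE : WeaklyConsistent Θ ρ E)
    {J : ℝ} (hJ0 : 0 ≤ J)
    (hJ : ∀ y : ℝ, J / 2 < y → ∀ᶠ θ in 𝓝[S \ {θ₁}] θ₁,
      supMeasuredDiv.{u} (ρ θ) (ρ θ₁) ≤ ENNReal.ofReal (y * (θ - θ₁) ^ 2))
    (hSΘ : S ⊆ Θ) {φ : ℝ → ℝ → ℝ} (hφ : ∀ b > 0, Tendsto (φ b) (𝓝[>] 0) (𝓝[S \ {θ₁}] θ₁))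
    (hφ' : ∀ b > 0, ∀ ε > 0, |φ b ε - θ₁| = b * ε) :
    alpha ρ E θ₁ ≤ ((J / 2 : ℝ) : EReal) := by
  refine EReal.le_of_forall_lt_iff_le.mp fun y hy => ?_
  have hy : J / 2 < y := EReal.coe_lt_coe_iff.mp hy
  set z : ℝ := (J / 2 + y) / 2 with hz
  have hz0 : 0 < z := by linarith
  obtain ⟨b, hb1, hb⟩ : ∃ b : ℝ, 1 < b ∧ z * b ^ 2 < y := by
    have h1 : Tendsto (fun b : ℝ => z * b ^ 2) (𝓝[>] 1) (𝓝 (z * 1 ^ 2)) :=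
      ((continuous_const.mul (continuous_id.pow 2)).tendsto 1).mono_left nhdsWithin_le_nhds
    obtain ⟨b, h2, h3⟩ := ((h1.eventually (gt_mem_nhds (show z * 1 ^ 2 < y by linarith))).and
      self_mem_nhdsWithin).exists
    exact ⟨b, h3, h2⟩
  have hb0 : 0 < b := one_pos.trans hb1
  refine limsup_le_of_le (by isBoundedDefault) ?_
  filter_upwards [(hφ b hb0).eventually (hJ z (by linarith)),
    (hφ b hb0).eventually self_mem_nhdsWithin, self_mem_nhdsWithin] with ε h1 h2 h3
  have hε : 0 < ε := h3
  have hdist := hφ' b hb0 ε hε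
  have hβ := beta_le_supMeasuredDiv (θ₁ := θ₁) (ε := ε) hsep hE (hSΘ h2.1)
    (by rw [hdist]; nlinarith)
  have hε2 : 0 < ε ^ 2 := by positivity
  rw [EReal.div_le_iff_le_mul (by exact_mod_cast hε2) (EReal.coe_ne_top _), ← EReal.coe_mul]
  refine (hβ.trans (EReal.coe_ennreal_le_coe_ennreal_iff.mpr h1)).trans ?_
  rw [EReal.coe_ennreal_ofReal, max_eq_left (by positivity), EReal.coe_le_coe_iff, ← sq_abs, hdist]
  nlinarith

theorem alpha_le (hsep : ∀ n, (E n).povm.IsSeparable) (hE : WeaklyConsistent Θ ρ E)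
    (hΘ : ∃ δ > 0, Set.Icc θ₁ (θ₁ + δ) ⊆ Θ ∨ Set.Icc (θ₁ - δ) θ₁ ⊆ Θ)
    (hker : ∀ᶠ θ in 𝓝[Θ] θ₁, ∀ x : d → ℂ,
      (ρ θ₁).toMatrix.mulVec x = 0 → (ρ θ).toMatrix.mulVec x = 0)
    (hL : IsSLD Θ ρ θ₁ L) : alpha ρ E θ₁ ≤ ((sldFisher (ρ θ₁) L / 2 : ℝ) : EReal) := by
  have hJ0 : 0 ≤ sldFisher (ρ θ₁) L := by
    have h := ((ρ θ₁).posSemidef.mul_mul_conjTranspose_same L).trace_nonneg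
    rw [hL.1.eq] at h
    rw [sldFisher_eq_trace]
    exact (Complex.nonneg_iff.mp h).1
  obtain ⟨δ, hδ, hS | hS⟩ := hΘ
  · have hu : UniqueDiffWithinAt ℝ (Set.Icc θ₁ (θ₁ + δ)) θ₁ :=
      uniqueDiffOn_Icc (by linarith) _ ⟨le_rfl, by linarith⟩
    refine alpha_le_of_tendsto hsep hE hJ0 (fun y hy => IsSLD.eventually_supMeasuredDiv_le
      ⟨hL.1, fun i j => (hL.2 i j).mono hS⟩ hu (nhdsWithin_mono _ hS hker) hy) hS
      (φ := fun b ε => θ₁ + b * ε) (fun b hb => ?_) fun b hb ε hε => ?_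
    · refine tendsto_nhdsWithin_iff.mpr ⟨?_, ?_⟩
      · have : Continuous fun ε => θ₁ + b * ε := by fun_prop
        simpa using (this.tendsto 0).mono_left nhdsWithin_le_nhds
      · filter_upwards [Ioo_mem_nhdsGT (show (0 : ℝ) < δ / b by positivity)] with ε hε
        have h1 := (lt_div_iff₀ hb).mp hε.2
        have h2 := mul_pos hb hε.1
        exact ⟨⟨by linarith, by linarith⟩, fun h => by
          have : θ₁ + b * ε = θ₁ := h
          linarith⟩
    · rw [add_sub_cancel_left, abs_of_pos (mul_pos hb hε)]
  · have hu : UniqueDiffWithinAt ℝ (Set.Icc (θ₁ - δ) θ₁) θ₁ :=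
      uniqueDiffOn_Icc (by linarith) _ ⟨by linarith, le_rfl⟩
    refine alpha_le_of_tendsto hsep hE hJ0 (fun y hy => IsSLD.eventually_supMeasuredDiv_le
      ⟨hL.1, fun i j => (hL.2 i j).mono hS⟩ hu (nhdsWithin_mono _ hS hker) hy) hS
      (φ := fun b ε => θ₁ - b * ε) (fun b hb => ?_) fun b hb ε hε => ?_
    · refine tendsto_nhdsWithin_iff.mpr ⟨?_, ?_⟩
      · have : Continuous fun ε => θ₁ - b * ε := by fun_prop
        simpa using (this.tendsto 0).mono_left nhdsWithin_le_nhds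
      · filter_upwards [Ioo_mem_nhdsGT (show (0 : ℝ) < δ / b by positivity)] with ε hε
        have h1 := (lt_div_iff₀ hb).mp hε.2
        have h2 := mul_pos hb hε.1
        exact ⟨⟨by linarith, by linarith⟩, fun h => by
          have : θ₁ - b * ε = θ₁ := h
          linarith⟩
    · rw [sub_sub_cancel_left, abs_neg, abs_of_pos (mul_pos hb hε)]

end LocalBound

end QuantumEstimation

/-! ### The main theorem -/

theorem mainTheorem6 {d : Type v} [Fintype d] [DecidableEq d]
    (Θ : Set ℝ) (ρ : ℝ → QuantumEstimation.DensityMatrix d) (θ₁ : ℝ) (hθ₁ : θ₁ ∈ Θ) :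
    -- bounds for weakly consistent sequences of separable estimators
    (∀ E : (n : ℕ) → QuantumEstimation.Estimator.{u} d n,
      (∀ n, (E n).povm.IsSeparable) →
      QuantumEstimation.WeaklyConsistent Θ ρ E →
      (∀ ε > 0, QuantumEstimation.beta ρ E θ₁ ε ≤
        ((⨅ θ ∈ {θ ∈ Θ | ε < |θ - θ₁|},
          QuantumEstimation.supMeasuredDiv.{u} (ρ θ) (ρ θ₁) : ℝ≥0∞) : EReal)) ∧
      (∀ L : Matrix d d ℂ,
        (∃ δ > 0, Set.Icc θ₁ (θ₁ + δ) ⊆ Θ ∨ Set.Icc (θ₁ - δ) θ₁ ⊆ Θ) →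
        (∀ᶠ θ in 𝓝[Θ] θ₁, ∀ x : d → ℂ,
          (ρ θ₁).toMatrix.mulVec x = 0 → (ρ θ).toMatrix.mulVec x = 0) →
        QuantumEstimation.IsSLD Θ ρ θ₁ L →
        QuantumEstimation.alpha ρ E θ₁ ≤
          ((QuantumEstimation.sldFisher (ρ θ₁) L / 2 : ℝ) : EReal))) ∧
    -- adaptive measurements are separable, so the bounds apply to adaptive estimators
    (∀ (n : ℕ) (Ω : Type u) [MeasurableSpace Ω]
      (M : QuantumEstimation.POVM (Fin n → Ω) (Fin n → d)),
      M.IsAdaptive → M.IsSeparable) := by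
  refine ⟨fun E hsep hE => ⟨fun ε _ => QuantumEstimation.beta_le_iInf hsep hE,
    fun L hΘ hker hL => QuantumEstimation.alpha_le hsep hE hΘ hker hL⟩, ?_⟩
  intro n Ω _ M hM
  exact hM.isSeparable
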